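/- An ordered graph is a finite simple graph with a linear order on its vertex set. An ordered homomorphism $G\to H$ is a map $f\colon V(G)\to V(H)$ that preserves edges and satisfies $u\le v\Rightarrow f(u)\le f(v)$. Subgraphs of $G$ carry the induced vertex order. $G$ order-retracts to a subgraph $H$ if there is an ordered homomorphism $G\to H$ that is the identity on $V(H)$; $G$ is a core if it does not order-retract to a proper subgraph; the core of $G$ is the subgraph $H$ of $G$ (unique up to isomorphism) that is a core and to which $G$ has an ordered homomorphism. The ordered chromatic number $\chi^<(G)$ is the least $k$ such that $V(G)$ can be partitioned into $k$ independent intervals. $\mathrm{CORE}_<^k$ is the problem, parameterized by $k$: given an ordered graph $G$ and $k\in\mathbb N$, is there an ordered homomorphism $G\to H$ to some proper ordered subgraph $H$ of $G$ with $|V(H)|=k$? $\mathrm{CORE}_<^{\chi^<(G)}$ is the promise problem, parameterized by $k=\chi^<(G)$: given an ordered graph $G$ with $\chi^<(G)=k$, decide between the cases that (1) the core of $G$ has $k$ vertices, and (2) $G$ is a core (if both hold, either answer is correct). Both $\mathrm{CORE}_<^k$ and $\mathrm{CORE}_<^{\chi^<(G)}$ can be solved in time $n^{O(k)}$ on $n$-vertex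 instances; the same holds for deciding, on every ordered graph $G$ and without a promise, whether the core of $G$ has $\chi^<(G)=k$ vertices. More precisely, for each problem there are a random access machine program (unit-cost addition and subtraction on natural numbers, no multiplication) and a constant $c$ such that the program solves every instance with $n$ vertices and parameter $k$ in at most $\max(n,2)^{c\max(k,1)}$ steps. Hence these problems are in $\mathrm{XP}$ when parameterized by $k$: they can be solved in time $f(k)\cdot|x|^{g(k)}$ on inputs $x$ of bit length $|x|$, with computable functions $f,g$. -/

import Mathlib

/-! ## Ordered graphs -/

/-- There is an ordered homomorphism from `G` to `H`: a map of the vertices preserving the edges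
and the (non-strict) order. -/
def HasOrderedHom {V W : Type*} [LinearOrder V] [LinearOrder W]
    (G : SimpleGraph V) (H : SimpleGraph W) : Prop :=
  ∃ f : G →g H, Monotone f

/-- `G` order-retracts to its subgraph `H`: there is an ordered homomorphism from `G` to `H` that
is the identity on the vertices of `H`. Subgraphs carry the induced vertex order. -/
def OrderRetractsTo {V : Type*} [LinearOrder V] (G : SimpleGraph V) (H : G.Subgraph) : Prop :=
  ∃ f : G →g H.coe, Monotone f ∧ ∀ v : H.verts, f v = v

/-- `G` is an (ordered) core: it does not order-retract to a proper subgraph. -/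
def IsOrderedCore {V : Type*} [LinearOrder V] (G : SimpleGraph V) : Prop :=
  ∀ H : G.Subgraph, H ≠ ⊤ → ¬ OrderRetractsTo G H

/-- The subgraph `H` of `G` is the core of `G` (it is unique up to isomorphism): it is a core, and
`G` admits an ordered homomorphism to it. -/
def IsCoreOf {V : Type*} [LinearOrder V] (G : SimpleGraph V) (H : G.Subgraph) : Prop :=
  IsOrderedCore H.coe ∧ HasOrderedHom G H.coe

/-- The core of `G` has `k` vertices. -/
def CoreHasCard {V : Type*} [LinearOrder V] (G : SimpleGraph V) (k : ℕ) : Prop :=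
  ∃ H : G.Subgraph, IsCoreOf G H ∧ H.verts.ncard = k

/-- The vertex set can be partitioned into `k` (possibly empty) independent intervals. -/
def IntervalColorable {V : Type*} [LinearOrder V] (G : SimpleGraph V) (k : ℕ) : Prop :=
  ∃ c : V → Fin k, ∀ i : Fin k, (c ⁻¹' {i}).OrdConnected ∧ G.IsIndepSet (c ⁻¹' {i})

/-- The ordered (interval) chromatic number. On a finite graph the set is non-empty. -/
noncomputable def orderedChromaticNumber {V : Type*} [LinearOrder V] (G : SimpleGraph V) : ℕ :=
  sInf {k : ℕ | IntervalColorable G k}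

/-! ## A random access machine with unit-cost addition and subtraction

Programs are structured (`while`-programs) over registers and an indirectly addressed memory, all
of whose cells hold natural numbers. There is no unit-cost multiplication, so the model is
polynomially equivalent to Turing machines. -/

/-- A configuration: the registers and the memory. -/
structure RAMState where
  reg : ℕ → ℕ
  mem : ℕ → ℕ

/-- Programs. A program is a finite object, so it mentions only finitely many registers. -/
inductive RAMProg where
  /-- do nothing -/
  | skip : RAMProg
  /-- `reg r := c` -/
  | const (r c : ℕ) : RAMProg
  /-- `reg r := reg a + reg b` -/
  | add (r a b : ℕ) : RAMProg
  /-- `reg r := reg a - reg b` (truncated at zero) -/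
  | sub (r a b : ℕ) : RAMProg
  /-- `reg r := mem (reg a)` -/
  | load (r a : ℕ) : RAMProg
  /-- `mem (reg a) := reg b` -/
  | store (a b : ℕ) : RAMProg
  /-- first `p`, then `q` -/
  | seq (p q : RAMProg) : RAMProg
  /-- if `reg a ≠ 0` then `p` else `q` -/
  | ite (a : ℕ) (p q : RAMProg) : RAMProg
  /-- while `reg a ≠ 0` do `p` -/
  | loop (a : ℕ) (p : RAMProg) : RAMProg

/-- Assign the value `v` to the register `r`. -/
def RAMState.setReg (s : RAMState) (r v : ℕ) : RAMState :=
  { s with reg := Function.update s.reg r v }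

/-- Write the value `v` into the memory cell `a`. -/
def RAMState.setMem (s : RAMState) (a v : ℕ) : RAMState :=
  { s with mem := Function.update s.mem a v }

/-- `RAMRun p s s' t`: the program `p`, started in the configuration `s`, halts in the
configuration `s'` after exactly `t` steps. Every elementary instruction and every test is one
step. -/
inductive RAMRun : RAMProg → RAMState → RAMState → ℕ → Prop
  | skip (s : RAMState) : RAMRun .skip s s 1
  | const (s : RAMState) (r c : ℕ) : RAMRun (.const r c) s (s.setReg r c) 1
  | add (s : RAMState) (r a b : ℕ) :
      RAMRun (.add r a b) s (s.setReg r (s.reg a + s.reg b)) 1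
  | sub (s : RAMState) (r a b : ℕ) :
      RAMRun (.sub r a b) s (s.setReg r (s.reg a - s.reg b)) 1
  | load (s : RAMState) (r a : ℕ) :
      RAMRun (.load r a) s (s.setReg r (s.mem (s.reg a))) 1
  | store (s : RAMState) (a b : ℕ) :
      RAMRun (.store a b) s (s.setMem (s.reg a) (s.reg b)) 1
  | seq {p q : RAMProg} {s s' s'' : RAMState} {t t' : ℕ} :
      RAMRun p s s' t → RAMRun q s' s'' t' → RAMRun (.seq p q) s s'' (t + t')
  | ite_true {a : ℕ} {p q : RAMProg} {s s' : RAMState} {t : ℕ} :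
      s.reg a ≠ 0 → RAMRun p s s' t → RAMRun (.ite a p q) s s' (t + 1)
  | ite_false {a : ℕ} {p q : RAMProg} {s s' : RAMState} {t : ℕ} :
      s.reg a = 0 → RAMRun q s s' t → RAMRun (.ite a p q) s s' (t + 1)
  | loop_stop {a : ℕ} {p : RAMProg} {s : RAMState} :
      s.reg a = 0 → RAMRun (.loop a p) s s 1
  | loop_step {a : ℕ} {p : RAMProg} {s s' s'' : RAMState} {t t' : ℕ} :
      s.reg a ≠ 0 → RAMRun p s s' t → RAMRun (.loop a p) s' s'' t' →
      RAMRun (.loop a p) s s'' (t + t' + 1)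

/-- The initial configuration on the input `w`: the memory holds `w` (and zeros behind it),
register `0` holds the length of `w`, and all other registers are zero. -/
def RAMState.init (w : List ℕ) : RAMState where
  reg := Function.update (fun _ => 0) 0 w.length
  mem := fun i => w.getD i 0

/-- The bit size of an input, each number being charged its binary length plus a separator. -/
def inputSize (w : List ℕ) : ℕ := (w.map fun a => Nat.size a + 1).sum

/-! ## Parameterized problems -/

/-- A parameterized promise problem on graph instances. On an instance for which one of `Yes`
and `No` holds, one of them that holds has to be found. A decision problem is the case in which
`No` is the negation of `Yes`. -/
structure ParamProblem where
  Inst : Type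
  /-- how an instance is written on the input -/
  encode : Inst → List ℕ
  /-- the number of vertices of the instance -/
  numVerts : Inst → ℕ
  /-- the parameter -/
  param : Inst → ℕ
  Yes : Inst → Prop
  No : Inst → Prop

/-- The answer `b` (`1` for yes, `0` for no) is correct on an instance satisfying the promise. -/
def ParamProblem.CorrectAnswer (P : ParamProblem) (x : P.Inst) (b : ℕ) : Prop :=
  P.Yes x ∨ P.No x → (b = 1 ∧ P.Yes x) ∨ (b = 0 ∧ P.No x)

/-- The program `p` solves `P` and takes at most `T x` steps on every instance `x`; the answer is
read off register `0`. -/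
def ParamProblem.SolvedBy (P : ParamProblem) (p : RAMProg) (T : P.Inst → ℕ) : Prop :=
  ∀ x : P.Inst, ∃ (s : RAMState) (t : ℕ),
    RAMRun p (RAMState.init (P.encode x)) s t ∧ t ≤ T x ∧ P.CorrectAnswer x (s.reg 0)

/-- `P` can be solved in time `n ^ O(k)` on `n`-vertex instances with parameter `k`. The
maxima only matter for `n ≤ 1` or `k = 0`, where `n ^ O(k)` read literally would be constant. -/
def ParamProblem.SolvableInTimePow (P : ParamProblem) : Prop :=
  ∃ (p : RAMProg) (c : ℕ),
    P.SolvedBy p fun x => max (P.numVerts x) 2 ^ (c * max (P.param x) 1)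

/-- `P` is in XP: it can be solved in time `f k * size ^ g k` with computable `f` and `g`. -/
def ParamProblem.InXP (P : ParamProblem) : Prop :=
  ∃ (p : RAMProg) (f g : ℕ → ℕ), Computable f ∧ Computable g ∧
    P.SolvedBy p fun x => f (P.param x) * inputSize (P.encode x) ^ g (P.param x)

/-! ## The two problems

Ordered graph instances have the vertex set `Fin n` with its usual order. -/

/-- A finite ordered graph as an instance. -/
abbrev OrderedGraphInst : Type := Σ n : ℕ, SimpleGraph (Fin n)

open Classical in
/-- The number of vertices followed by the adjacency matrix, row by row. -/
noncomputable def OrderedGraphInst.encode (G : OrderedGraphInst) : List ℕ :=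
  G.1 :: List.ofFn fun i : Fin (G.1 * G.1) => if G.2.Adj i.divNat i.modNat then 1 else 0

/-- Given `(G, k)`, with parameter `k`: is there an ordered homomorphism from `G` to some proper
ordered subgraph of `G` with exactly `k` vertices? -/
noncomputable def coreK : ParamProblem where
  Inst := OrderedGraphInst × ℕ
  encode x := x.2 :: x.1.encode
  numVerts x := x.1.1
  param x := x.2
  Yes x := ∃ H : x.1.2.Subgraph, H ≠ ⊤ ∧ H.verts.ncard = x.2 ∧ HasOrderedHom x.1.2 H.coe
  No x := ¬ ∃ H : x.1.2.Subgraph, H ≠ ⊤ ∧ H.verts.ncard = x.2 ∧ HasOrderedHom x.1.2 H.coe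

/-- Given `G`, with parameter `k`, the ordered chromatic number of `G`: decide between the cases
that the core of `G` has `k` vertices, and that `G` is a core. -/
noncomputable def coreChi : ParamProblem where
  Inst := OrderedGraphInst
  encode G := G.encode
  numVerts G := G.1
  param G := orderedChromaticNumber G.2
  Yes G := CoreHasCard G.2 (orderedChromaticNumber G.2)
  No G := IsOrderedCore G.2

/-- The version of `coreChi` without a promise: on every ordered graph `G`, decide whether the core
of `G` has as many vertices as the ordered chromatic number of `G`. -/
noncomputable def coreChiTotal : ParamProblem :=
  { coreChi with No := fun G => ¬ CoreHasCard G.2 (orderedChromaticNumber G.2) }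

/-! A monotone map with at most `k` values is a step function: it is determined by its values and,
for each value, the least vertex mapped to it. So on `n` vertices `2 * k` numbers below `n` describe
every such map, and conversely every such list with `k ≥ 1` decodes to a monotone map with at most
`k` values (`stepFun_mono`, `exists_stepFun_eq`, `exists_homOK_iff`). A program that counts through
all lists in base `n` and tests each one against the adjacency matrix in polynomial time therefore
runs in time `n ^ O(k)` (`exec_search`, `time_le`).

Both questions reduce to the existence of an ordered endomorphism with small image. Fibres of an
ordered homomorphism are independent intervals, so no target of `G` has fewer vertices than the
ordered chromatic number; hence the core has that many vertices iff some endomorphism has an image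
of at most that size (`coreHasCard_iff`). For `coreK` with `k < n` the image can be enlarged to `k`
vertices, whose induced subgraph is proper; for `k = n` a proper subgraph has to miss an edge, so
two more digits guess an edge that is not hit (`exists_proper_subgraph_iff`). The ordered chromatic
number itself is computed by the greedy partition (`orderedChromaticNumber_eq`, `exec_greedy`).

Each program is verified by a weakest-precondition calculus for `Exec`, whose postconditions also
bound the number of steps. -/

/-! ## Reasoning about random access machine programs -/

namespace RAMProg

/-- Some run of `p` from `s` ends in a configuration and after a number of steps that
satisfy `Q`. -/
def Exec (p : RAMProg) (s : RAMState) (Q : RAMState → ℕ → Prop) : Prop :=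
  ∃ s' t, RAMRun p s s' t ∧ Q s' t

section Exec
variable {s : RAMState} {Q : RAMState → ℕ → Prop}

theorem exec_skip : Exec .skip s Q ↔ Q s 1 :=
  ⟨by rintro ⟨_, _, ⟨⟩, h⟩; exact h, fun h => ⟨_, _, .skip s, h⟩⟩

theorem exec_const {r c : ℕ} : Exec (.const r c) s Q ↔ Q (s.setReg r c) 1 :=
  ⟨by rintro ⟨_, _, ⟨⟩, h⟩; exact h, fun h => ⟨_, _, .const s r c, h⟩⟩

theorem exec_add {r a b : ℕ} : Exec (.add r a b) s Q ↔ Q (s.setReg r (s.reg a + s.reg b)) 1 :=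
  ⟨by rintro ⟨_, _, ⟨⟩, h⟩; exact h, fun h => ⟨_, _, .add s r a b, h⟩⟩

theorem exec_sub {r a b : ℕ} : Exec (.sub r a b) s Q ↔ Q (s.setReg r (s.reg a - s.reg b)) 1 :=
  ⟨by rintro ⟨_, _, ⟨⟩, h⟩; exact h, fun h => ⟨_, _, .sub s r a b, h⟩⟩

theorem exec_load {r a : ℕ} : Exec (.load r a) s Q ↔ Q (s.setReg r (s.mem (s.reg a))) 1 :=
  ⟨by rintro ⟨_, _, ⟨⟩, h⟩; exact h, fun h => ⟨_, _, .load s r a, h⟩⟩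

theorem exec_store {a b : ℕ} : Exec (.store a b) s Q ↔ Q (s.setMem (s.reg a) (s.reg b)) 1 :=
  ⟨by rintro ⟨_, _, ⟨⟩, h⟩; exact h, fun h => ⟨_, _, .store s a b, h⟩⟩

theorem exec_seq {p q : RAMProg} :
    Exec (.seq p q) s Q ↔ Exec p s fun s₁ t₁ => Exec q s₁ fun s₂ t₂ => Q s₂ (t₁ + t₂) :=
  ⟨by
    rintro ⟨_, _, ⟨⟩, h⟩
    exact ⟨_, _, ‹RAMRun p _ _ _›, _, _, ‹RAMRun q _ _ _›, h⟩,
   fun ⟨_, _, hp, _, _, hq, h⟩ => ⟨_, _, .seq hp hq, h⟩⟩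

theorem exec_ite {a : ℕ} {p q : RAMProg} :
    Exec (.ite a p q) s Q ↔
      if s.reg a = 0 then Exec q s fun s' t => Q s' (t + 1) else Exec p s fun s' t => Q s' (t + 1) := by
  split_ifs with h
  · constructor
    · rintro ⟨_, _, ⟨⟩, hQ⟩
      · contradiction
      · exact ⟨_, _, ‹_›, hQ⟩
    · rintro ⟨_, _, hr, hQ⟩
      exact ⟨_, _, .ite_false h hr, hQ⟩
  · constructor
    · rintro ⟨_, _, ⟨⟩, hQ⟩
      · exact ⟨_, _, ‹_›, hQ⟩
      · contradiction
    · rintro ⟨_, _, hr, hQ⟩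
      exact ⟨_, _, .ite_true h hr, hQ⟩

end Exec

/-- `p` contains an instruction that assigns the register `r`. -/
def writesReg : RAMProg → ℕ → Bool
  | .skip, _ => false
  | .const r _, x => r == x
  | .add r _ _, x => r == x
  | .sub r _ _, x => r == x
  | .load r _, x => r == x
  | .store _ _, _ => false
  | .seq p q, x => writesReg p x || writesReg q x
  | .ite _ p q, x => writesReg p x || writesReg q x
  | .loop _ p, x => writesReg p x

/-- `p` contains a `store` instruction. -/
def writesMem : RAMProg → Bool
  | .store _ _ => true
  | .seq p q => writesMem p || writesMem q
  | .ite _ p q => writesMem p || writesMem q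
  | .loop _ p => writesMem p
  | _ => false

/-- What a run of `p` from `s` to `s'` certainly leaves unchanged. -/
def Frame (p : RAMProg) (s s' : RAMState) : Prop :=
  (∀ r, p.writesReg r = false → s'.reg r = s.reg r) ∧ (p.writesMem = false → s'.mem = s.mem)

/-- Since `writesReg` and `writesMem` are Boolean functions of the program text, for a concrete
program each unchanged register is obtained by `rfl`. -/
theorem frame_of_run {p : RAMProg} {s s' : RAMState} {t : ℕ} (h : RAMRun p s s' t) :
    Frame p s s' := by
  induction h with
  | skip => exact ⟨fun _ _ => rfl, fun _ => rfl⟩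
  | const | add | sub | load =>
    refine ⟨fun x hx => ?_, fun _ => rfl⟩
    simp only [writesReg, beq_eq_false_iff_ne] at hx
    simp [RAMState.setReg, hx.symm]
  | store => exact ⟨fun _ _ => rfl, fun h => by simp [writesMem] at h⟩
  | seq _ _ ih₁ ih₂ =>
    refine ⟨fun x hx => ?_, fun hx => ?_⟩
    · simp only [writesReg, Bool.or_eq_false_iff] at hx
      rw [ih₂.1 x hx.2, ih₁.1 x hx.1]
    · simp only [writesMem, Bool.or_eq_false_iff] at hx
      rw [ih₂.2 hx.2, ih₁.2 hx.1]
  | ite_true _ _ ih =>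
    refine ⟨fun x hx => ih.1 x ?_, fun hx => ih.2 ?_⟩
    · simp only [writesReg, Bool.or_eq_false_iff] at hx; exact hx.1
    · simp only [writesMem, Bool.or_eq_false_iff] at hx; exact hx.1
  | ite_false _ _ ih =>
    refine ⟨fun x hx => ih.1 x ?_, fun hx => ih.2 ?_⟩
    · simp only [writesReg, Bool.or_eq_false_iff] at hx; exact hx.2
    · simp only [writesMem, Bool.or_eq_false_iff] at hx; exact hx.2
  | loop_stop => exact ⟨fun _ _ => rfl, fun _ => rfl⟩
  | loop_step _ _ _ ih₁ ih₂ =>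
    refine ⟨fun x hx => ?_, fun hx => ?_⟩
    · rw [ih₂.1 x hx, ih₁.1 x hx]
    · rw [ih₂.2 hx, ih₁.2 hx]

/-- The consequence rule with the frame supplied for free, so specifications need only mention what
a program changes. -/
theorem Exec.imp {p : RAMProg} {s : RAMState} {Q Q' : RAMState → ℕ → Prop} (h : Exec p s Q)
    (hQ : ∀ s' t, Frame p s s' → Q s' t → Q' s' t) : Exec p s Q' :=
  let ⟨_, _, hr, hq⟩ := h
  ⟨_, _, hr, hQ _ _ (frame_of_run hr) hq⟩

/-- A loop whose test register becomes zero for the first time after the `N`-th round. -/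
theorem exec_loop {a : ℕ} {p : RAMProg} {T : ℕ} (I : ℕ → RAMState → Prop) (N : ℕ)
    (htest : ∀ j s, I j s → (s.reg a = 0 ↔ j = N))
    (hstep : ∀ j s, j < N → I j s → Exec p s fun s' t => t ≤ T ∧ I (j + 1) s')
    {s : RAMState} (h : I 0 s) :
    Exec (.loop a p) s fun s' t => t ≤ N * (T + 1) + 1 ∧ I N s' := by
  suffices H : ∀ d j s, j + d = N → I j s →
      Exec (.loop a p) s fun s' t => t ≤ d * (T + 1) + 1 ∧ I N s' from H N 0 s (by simp) h
  intro d
  induction d with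
  | zero =>
    rintro j s rfl hI
    exact ⟨s, 1, RAMRun.loop_stop ((htest _ _ hI).2 rfl), by simp, hI⟩
  | succ d ih =>
    intro j s hj hI
    obtain ⟨s₁, t₁, hr₁, ht₁, hI₁⟩ := hstep j s (by omega) hI
    obtain ⟨s₂, t₂, hr₂, ht₂, hI₂⟩ := ih (j + 1) s₁ (by omega) hI₁
    refine ⟨s₂, _, RAMRun.loop_step (fun h0 => ?_) hr₁ hr₂, ?_, hI₂⟩
    · have := (htest _ _ hI).1 h0
      omega
    · rw [Nat.add_mul, one_mul]
      omega

/-- `reg r := reg a`, for different `r` and `a`. -/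
def mov (r a : ℕ) : RAMProg := .seq (.const r 0) (.add r a r)

/-- Run `p` with `reg i = 0, 1, …, reg n - 1`. Register `r` is used for the test. -/
def forLoop (r i n : ℕ) (p : RAMProg) : RAMProg :=
  .seq (.const i 0) <| .seq (.sub r n i) <| .loop r <|
    .seq p <| .seq (.const r 1) <| .seq (.add i i r) (.sub r n i)

/-- The loop control overwrites `i` and `r` after each round, so the invariant must not depend on
them (`hstable`). Each round costs three control instructions and a test on top of the body; the
setup and the last test account for the final `3`. -/
theorem exec_forLoop {r i n : ℕ} {p : RAMProg} {T N : ℕ} {s₀ : RAMState}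
    (I : ℕ → RAMState → Prop)
    (hir : i ≠ r) (hni : n ≠ i) (hnr : n ≠ r)
    (hpi : p.writesReg i = false) (hpn : p.writesReg n = false)
    (hN : s₀.reg n = N)
    (hstable : ∀ j s v w, I j s → I j ((s.setReg i v).setReg r w))
    (hstep : ∀ j s, j < N → Frame (forLoop r i n p) s₀ s → s.reg i = j → I j s →
      Exec p s fun s' t => t ≤ T ∧ I (j + 1) s')
    (h : I 0 s₀) :
    Exec (forLoop r i n p) s₀ fun s' t => t ≤ N * (T + 4) + 3 ∧ I N s' := by
  have hw : ∀ x, (forLoop r i n p).writesReg x = false → x ≠ i ∧ x ≠ r ∧ p.writesReg x = false := by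
    intro x hx
    simp only [forLoop, writesReg, Bool.or_eq_false_iff, beq_eq_false_iff_ne] at hx
    exact ⟨hx.1.symm, hx.2.1.symm, hx.2.2.1⟩
  have hm : (forLoop r i n p).writesMem = false → p.writesMem = false := by
    intro hx
    simp only [forLoop, writesMem, Bool.or_eq_false_iff] at hx
    tauto
  rw [forLoop, exec_seq, exec_const, exec_seq, exec_sub]
  refine Exec.imp (exec_loop (T := T + 3)
    (fun j s => j ≤ N ∧ I j s ∧ s.reg i = j ∧ s.reg n = N ∧ s.reg r = N - j ∧
      Frame (forLoop r i n p) s₀ s) N ?_ ?_ ?_) ?_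
  · rintro j s ⟨h1, -, -, -, h2, -⟩
    omega
  · rintro j s hj ⟨-, hI, hi, hn, -, hf⟩
    rw [exec_seq]
    refine (hstep j s hj hf hi hI).imp ?_
    rintro s₁ t₁ hf₁ ⟨ht₁, hI₁⟩
    simp only [exec_seq, exec_const, exec_add, exec_sub]
    have hi₁ := hf₁.1 i hpi
    have hn₁ := hf₁.1 n hpn
    refine ⟨by omega, by omega, ?_, ?_, ?_, ?_, ?_, ?_⟩
    · have := hstable _ _ (s₁.reg i + 1) (N - (j + 1)) hI₁
      convert this using 1
      simp only [RAMState.setReg, RAMState.mk.injEq, and_true]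
      funext x
      by_cases hxr : x = r
      · subst hxr
        simp [hir, hni, hnr, hn₁, hn, hi₁, hi]
      · by_cases hxi : x = i
        · subst hxi
          simp [hxr]
        · simp [hxr, hxi]
    · simp [RAMState.setReg, hir, hi₁, hi]
    · simp [RAMState.setReg, hnr, hni, hn₁, hn]
    · simp [RAMState.setReg, hnr, hni, hn₁, hn, hir, hi₁, hi]
    · intro x hx
      obtain ⟨h1, h2, h3⟩ := hw x hx
      simp [RAMState.setReg, h1, h2, hf₁.1 x h3, hf.1 x hx]
    · intro hx
      simp [RAMState.setReg, hf₁.2 (hm hx), hf.2 hx]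
  · refine ⟨by omega, hstable _ _ _ _ h, ?_, ?_, ?_, ?_, ?_⟩
    · simp [RAMState.setReg, hir]
    · simp [RAMState.setReg, hni, hnr, hN]
    · simp [RAMState.setReg, hni, hN]
    · intro x hx
      obtain ⟨h1, h2, -⟩ := hw x hx
      simp [RAMState.setReg, h1, h2]
    · intro _
      simp [RAMState.setReg]
  · rintro s' t - ⟨ht, -, hI, -⟩
    refine ⟨?_, hI⟩
    have : N * (T + 3 + 1) = N * (T + 4) := by ring
    omega

end RAMProg

/-! ### Effect of single writes on registers and memory. -/

namespace RAMState

theorem reg_setReg (s : RAMState) (r v x : ℕ) :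
    (s.setReg r v).reg x = if x = r then v else s.reg x := by
  simp [setReg, Function.update_apply]

theorem mem_setReg (s : RAMState) (r v : ℕ) : (s.setReg r v).mem = s.mem := rfl

theorem reg_setMem (s : RAMState) (a v : ℕ) : (s.setMem a v).reg = s.reg := rfl

theorem mem_setMem (s : RAMState) (a v x : ℕ) :
    (s.setMem a v).mem x = if x = a then v else s.mem x := by
  simp [setMem, Function.update_apply]

end RAMState

/-! ## Search for ordered homomorphisms -/

/-- The value at `x` of the monotone step function with the `k` steps `(a 2, a 3)`,
`(a 4, a 5)`, …: the maximum of the heights of the steps that start at or before `x`; the first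
step counts everywhere. -/
def stepFun (a : ℕ → ℕ) (x : ℕ) : ℕ → ℕ
  | 0 => a 3
  | i + 1 => if a (2 + 2 * i) ≤ x then max (stepFun a x i) (a (3 + 2 * i)) else stepFun a x i

namespace RAMProg
open RAMState

/-- `reg 24 := stepFun a (reg 23) (reg 2)`, where the values of `a` are stored from the address
`reg 0` on. -/
def evalStepFun : RAMProg :=
  .seq (.const 14 3) <| .seq (.add 16 0 14) <| .seq (.load 24 16) <|
  .seq (.const 14 2) <| .seq (.add 16 0 14) <| forLoop 15 14 2 <|
    .seq (.const 19 1) <| .seq (.load 17 16) <| .seq (.add 16 16 19) <|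
    .seq (.load 18 16) <| .seq (.add 16 16 19) <| .seq (.sub 17 17 23) <|
    .ite 17 .skip (.seq (.sub 17 18 24) (.add 24 24 17))

theorem exec_evalStepFun (s : RAMState) :
    Exec evalStepFun s fun s' t => t ≤ s.reg 2 * 13 + 8 ∧
      s'.reg 24 = stepFun (fun i => s.mem (s.reg 0 + i)) (s.reg 23) (s.reg 2) := by
  simp only [evalStepFun, exec_seq, exec_const, exec_add, exec_load]
  refine (exec_forLoop (T := 9) (N := s.reg 2)
    (fun j s' => s'.reg 16 = s.reg 0 + 2 + 2 * j ∧
      s'.reg 24 = stepFun (fun i => s.mem (s.reg 0 + i)) (s.reg 23) j)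
    (by decide) (by decide) (by decide) rfl rfl (by simp [reg_setReg]) ?_ ?_ ?_).imp ?_
  · intro j s' v w h
    simpa [reg_setReg] using h
  · rintro j s' hj hf hi ⟨h1, h2⟩
    have h23 := hf.1 23 rfl
    have hm := hf.2 rfl
    simp [reg_setReg, mem_setReg] at h23 hm
    have e : s.reg 0 + (2 + 2 * j) + 1 = s.reg 0 + (3 + 2 * j) := by ring
    have e' : s.reg 0 + 2 + 2 * j = s.reg 0 + (2 + 2 * j) := by ring
    simp only [exec_seq, exec_const, exec_add, exec_load, exec_sub, exec_ite, exec_skip,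
      reg_setReg, mem_setReg, h1, h2, h23, hm, stepFun]
    -- Truncated subtraction does both jobs: a zero difference tests whether the step has started,
    -- and adding `v - w` to `w` yields `max w v`.
    simp only [e', e, Nat.reduceEqDiff, if_true, if_false, Nat.sub_eq_zero_iff_le]
    split_ifs with h3
    · simp
      omega
    · simp
      omega
  · simp [reg_setReg, mem_setReg, stepFun]
  · rintro s' t - ⟨h1, -, h2⟩
    exact ⟨by omega, h2⟩

/-- `reg 13 := reg 3 + reg 11 * reg 1 + reg 12`. -/
def matrixAddr : RAMProg :=
  .seq (.add 13 3 12) <| forLoop 15 14 11 (.add 13 13 1)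

theorem exec_matrixAddr (s : RAMState) :
    Exec matrixAddr s fun s' t => t ≤ s.reg 11 * 5 + 4 ∧
      s'.reg 13 = s.reg 3 + s.reg 11 * s.reg 1 + s.reg 12 := by
  simp only [matrixAddr, exec_seq, exec_add]
  refine (exec_forLoop (T := 1) (N := s.reg 11)
    (fun j s' => s'.reg 13 = s.reg 3 + j * s.reg 1 + s.reg 12)
    (by decide) (by decide) (by decide) rfl rfl (by simp [reg_setReg]) ?_ ?_ ?_).imp ?_
  · intro j s' v w h
    simpa [reg_setReg] using h
  · rintro j s' hj hf hi h1
    have h2 := hf.1 1 rfl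
    simp [reg_setReg] at h2
    simp only [exec_add, reg_setReg, h1, h2]
    simp
    ring
  · simp [reg_setReg]
  · rintro s' t - ⟨h1, h2⟩
    exact ⟨by omega, h2⟩

theorem exec_mov {r a : ℕ} {s : RAMState} {Q : RAMState → ℕ → Prop} (h : a ≠ r) :
    Exec (mov r a) s Q ↔ Q (s.setReg r (s.reg a)) 2 := by
  have : ((s.setReg r 0).setReg r (s.reg a)) = s.setReg r (s.reg a) := by
    simp [setReg]
  simp [mov, exec_seq, exec_const, exec_add, reg_setReg, h, this]

/-- If the images of `x = reg 8` and `y = reg 9` under the step function are not adjacent, or if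
they form the forbidden edge, whose address is `reg 6`, then `reg 7 := 0`. -/
def checkEdge : RAMProg :=
  .seq (mov 23 8) <| .seq evalStepFun <| .seq (mov 11 24) <|
  .seq (mov 23 9) <| .seq evalStepFun <| .seq (mov 12 24) <| .seq matrixAddr <|
  .seq (.load 17 13) <| .ite 17
    (.seq (.sub 17 13 6) <| .seq (.sub 18 6 13) <| .seq (.add 17 17 18) <|
      .ite 17 .skip (.const 7 0))
    (.const 7 0)

/-- The condition that `checkEdge` tests. -/
def EdgeOK (M : ℕ → ℕ) (B n k off q x y : ℕ) : Prop :=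
  let F := fun z => stepFun (fun i => M (B + i)) z k
  M (off + F x * n + F y) ≠ 0 ∧ off + F x * n + F y ≠ q

theorem exec_checkEdge (s : RAMState) {n : ℕ}
    (hn : ∀ x, stepFun (fun i => s.mem (s.reg 0 + i)) x (s.reg 2) ≤ n) :
    Exec checkEdge s fun s' t => t ≤ s.reg 2 * 26 + n * 5 + 36 ∧
      (s'.reg 7 ≠ 0 ↔ s.reg 7 ≠ 0 ∧
        EdgeOK s.mem (s.reg 0) (s.reg 1) (s.reg 2) (s.reg 3) (s.reg 6) (s.reg 8) (s.reg 9)) := by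
  simp only [checkEdge, exec_seq, exec_mov (show 8 ≠ 23 by decide),
    exec_mov (show 24 ≠ 11 by decide), exec_mov (show 9 ≠ 23 by decide),
    exec_mov (show 24 ≠ 12 by decide)]
  refine (exec_evalStepFun _).imp ?_
  rintro s₁ t₁ hf₁ ⟨ht₁, h₁⟩
  refine (exec_evalStepFun _).imp ?_
  rintro s₂ t₂ hf₂ ⟨ht₂, h₂⟩
  refine (exec_matrixAddr _).imp ?_
  rintro s₃ t₃ hf₃ ⟨ht₃, h₃⟩
  have r₁ : ∀ r ∈ [0, 1, 2, 3, 6, 7, 9], s₁.reg r = s.reg r := by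
    intro r hr
    simp only [List.mem_cons, List.not_mem_nil, or_false] at hr
    rcases hr with rfl | rfl | rfl | rfl | rfl | rfl | rfl <;> exact (hf₁.1 _ rfl).trans rfl
  have r₂ : ∀ r ∈ [0, 1, 2, 3, 6, 7, 11], s₂.reg r = if r = 11 then s₁.reg 24 else s₁.reg r := by
    intro r hr
    simp only [List.mem_cons, List.not_mem_nil, or_false] at hr
    rcases hr with rfl | rfl | rfl | rfl | rfl | rfl | rfl <;> exact (hf₂.1 _ rfl).trans rfl
  have r₃ : ∀ r ∈ [6, 7], s₃.reg r = s.reg r := by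
    intro r hr
    simp only [List.mem_cons, List.not_mem_nil, or_false] at hr
    rcases hr with rfl | rfl
    <;> [exact ((hf₃.1 6 rfl).trans (r₂ 6 (by simp))).trans (r₁ 6 (by simp));
       exact ((hf₃.1 7 rfl).trans (r₂ 7 (by simp))).trans (r₁ 7 (by simp))]
  have m₁ : s₁.mem = s.mem := (hf₁.2 rfl).trans rfl
  have m₂ : s₂.mem = s.mem := ((hf₂.2 rfl).trans rfl).trans m₁
  have m₃ : s₃.mem = s.mem := ((hf₃.2 rfl).trans rfl).trans m₂
  simp [reg_setReg, mem_setReg] at ht₁ h₁ ht₂ h₂ ht₃ h₃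
  simp [r₁, m₁] at ht₂ h₂
  simp [r₁, r₂, h₁, h₂] at ht₃ h₃
  -- The image of `x` is the row index, hence the number of rounds of `matrixAddr`; its bound `n`
  -- enters only the time estimate.
  have hb := hn (s.reg 8)
  have ht : t₁ + t₂ + t₃ ≤ s.reg 2 * 26 + n * 5 + 20 := by omega
  simp only [exec_load, exec_ite, exec_seq, exec_sub, exec_add, exec_const, exec_skip, reg_setReg,
    EdgeOK, m₃, h₃]
  simp only [Nat.reduceEqDiff, if_true, if_false, r₃ 6 (by simp), r₃ 7 (by simp)]
  generalize s.reg 3 + _ + _ = A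
  split_ifs with c1 c2
  · simp [c1]
    omega
  -- The sum of the two truncated differences vanishes exactly when the addresses agree.
  · have : A = s.reg 6 := by omega
    simp [this]
    omega
  · have : A ≠ s.reg 6 := by omega
    simp [this, c1]
    omega

end RAMProg

/-- The base value `a 3` is the height of step number zero, so for `k ≥ 1` it adds no further value;
this is why the decoded map has at most `k` values. -/
theorem exists_stepFun_eq (a : ℕ → ℕ) (x : ℕ) {k : ℕ} (hk : 1 ≤ k) :
    ∃ j < k, stepFun a x k = a (3 + 2 * j) := by
  suffices H : ∀ k, stepFun a x k = a 3 ∨ ∃ j < k, stepFun a x k = a (3 + 2 * j) by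
    rcases H k with h | h
    · exact ⟨0, hk, h⟩
    · exact h
  intro k
  induction k with
  | zero => exact .inl rfl
  | succ i ih =>
    have hih : stepFun a x i = a 3 ∨ ∃ j < i + 1, stepFun a x i = a (3 + 2 * j) :=
      ih.imp_right fun ⟨j, hj, h⟩ => ⟨j, by omega, h⟩
    rw [stepFun]
    split_ifs
    · rcases max_choice (stepFun a x i) (a (3 + 2 * i)) with h | h
      · rwa [h]
      · exact .inr ⟨i, by omega, h⟩
    · exact hih

/-! ### Testing one candidate map, and enumerating all candidates with a base `n` counter. -/

namespace RAMProg
open RAMState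

/-- Apply `checkEdge` to all edges. If `reg 5 ≠ 0`, the first two stored numbers have to be an
edge, which is the forbidden one; if `reg 5 = 0` there is no forbidden edge. -/
def checkHom : RAMProg :=
  .seq (.ite 5
    (.seq (.const 14 1) <| .seq (.add 16 0 14) <| .seq (.load 11 0) <| .seq (.load 12 16) <|
      .seq matrixAddr <| .seq (mov 6 13) (.load 7 6))
    (.seq (.const 6 0) (.const 7 1))) <|
  .seq (mov 10 3) <| forLoop 15 8 1 <| forLoop 15 9 1 <|
    .seq (.load 17 10) <| .seq (.const 19 1) <| .seq (.add 10 10 19) <| .ite 17 checkEdge .skip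

/-- The address of the forbidden edge, or zero. -/
def forbiddenAddr (M : ℕ → ℕ) (B n off b : ℕ) : ℕ :=
  if b = 0 then 0 else off + M B * n + M (B + 1)

/-- The condition that `checkHom` tests. -/
def HomOK (M : ℕ → ℕ) (B n k off b : ℕ) : Prop :=
  (b = 0 ∨ M (forbiddenAddr M B n off b) ≠ 0) ∧
    ∀ x < n, ∀ y < n, M (off + x * n + y) ≠ 0 →
      EdgeOK M B n k off (forbiddenAddr M B n off b) x y

/-- Time bound for `checkHom`. -/
def checkTime (n k : ℕ) : ℕ :=
  n * (n * (26 * k + 5 * n + 44) + 7) + 3 + 5 * n + 15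

theorem exec_checkHom (s : RAMState) (hk : 1 ≤ s.reg 2)
    (hM : ∀ i < 2 * s.reg 2 + 2, s.mem (s.reg 0 + i) ≤ s.reg 1) :
    Exec checkHom s fun s' t => t ≤ checkTime (s.reg 1) (s.reg 2) ∧
      (s'.reg 7 ≠ 0 ↔ HomOK s.mem (s.reg 0) (s.reg 1) (s.reg 2) (s.reg 3) (s.reg 5)) := by
  set q := forbiddenAddr s.mem (s.reg 0) (s.reg 1) (s.reg 3) (s.reg 5) with hq
  rw [checkHom, exec_seq]
  have hinit : Exec (.ite 5
    (.seq (.const 14 1) <| .seq (.add 16 0 14) <| .seq (.load 11 0) <| .seq (.load 12 16) <|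
      .seq matrixAddr <| .seq (mov 6 13) (.load 7 6))
    (.seq (.const 6 0) (.const 7 1))) s fun s' t => t ≤ 5 * s.reg 1 + 12 ∧ s'.reg 6 = q ∧
      (s'.reg 7 ≠ 0 ↔ (s.reg 5 = 0 ∨ s.mem q ≠ 0)) := by
    simp only [exec_ite, exec_seq, exec_const, exec_add, exec_load, exec_mov (show 13 ≠ 6 by decide)]
    split_ifs with h5
    · simp [reg_setReg, hq, forbiddenAddr, h5]
    · refine (exec_matrixAddr _).imp ?_
      rintro s₁ t₁ hf₁ ⟨ht₁, h₁⟩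
      have hm : s₁.mem = s.mem := (hf₁.2 rfl).trans rfl
      have h0 := hM 0 (by omega)
      simp [reg_setReg, mem_setReg] at h₁ ht₁ h0
      simp only [reg_setReg, mem_setReg, h₁, hm, hq, forbiddenAddr, h5, if_false]
      simp
      omega
  refine hinit.imp ?_
  rintro s₁ t₁ hf₁ ⟨ht₁, h6, h7⟩
  have hm : s₁.mem = s.mem := (hf₁.2 rfl).trans rfl
  have r₁ : ∀ r ∈ [0, 1, 2, 3], s₁.reg r = s.reg r := by
    intro r hr
    simp only [List.mem_cons, List.not_mem_nil, or_false] at hr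
    rcases hr with rfl | rfl | rfl | rfl <;> exact hf₁.1 _ rfl
  rw [exec_seq, exec_mov (by decide)]
  set n := s.reg 1 with hn
  let P : ℕ → ℕ → Prop := fun x y => s.mem (s.reg 3 + x * n + y) ≠ 0 →
    EdgeOK s.mem (s.reg 0) n (s.reg 2) (s.reg 3) q x y
  -- Register `10` walks through the matrix row by row, so the address of the entry `(x, y)` needs
  -- no multiplication.
  refine (exec_forLoop (T := n * (26 * s.reg 2 + 5 * n + 44) + 3) (N := n)
    (fun x s' => s'.reg 10 = s.reg 3 + x * n ∧
      (s'.reg 7 ≠ 0 ↔ s₁.reg 7 ≠ 0 ∧ ∀ x' < x, ∀ y < n, P x' y))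
    (by decide) (by decide) (by decide) rfl rfl (by simp [reg_setReg, r₁, hn]) ?_ ?_ ?_).imp ?_
  · intro j s' v w h
    simpa [reg_setReg] using h
  · rintro x s₂ hx hf₂ hx8 ⟨h10, h27⟩
    have hm₂ : s₂.mem = s.mem := ((hf₂.2 rfl).trans rfl).trans hm
    have r₂ : ∀ r ∈ [0, 1, 2, 3, 6], s₂.reg r = s₁.reg r := by
      intro r hr
      simp only [List.mem_cons, List.not_mem_nil, or_false] at hr
      rcases hr with rfl | rfl | rfl | rfl | rfl <;> exact (hf₂.1 _ rfl).trans rfl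
    refine (exec_forLoop (T := 26 * s.reg 2 + 5 * n + 40) (N := n)
      (fun y s' => s'.reg 10 = s.reg 3 + x * n + y ∧
        (s'.reg 7 ≠ 0 ↔ s₂.reg 7 ≠ 0 ∧ ∀ y' < y, P x y'))
      (by decide) (by decide) (by decide) rfl rfl (by simp [r₁, r₂, hn]) ?_ ?_ ?_).imp ?_
    · intro j s' v w h
      simpa [reg_setReg] using h
    · rintro y s₃ hy hf₃ hy9 ⟨h310, h37⟩
      have hm₃ : s₃.mem = s.mem := ((hf₃.2 rfl).trans rfl).trans hm₂
      have r₃ : ∀ r ∈ [0, 1, 2, 3, 6, 8], s₃.reg r = s₂.reg r := by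
        intro r hr
        simp only [List.mem_cons, List.not_mem_nil, or_false] at hr
        rcases hr with rfl | rfl | rfl | rfl | rfl | rfl <;> exact (hf₃.1 _ rfl).trans rfl
      simp only [exec_seq, exec_load, exec_const, exec_add, exec_ite, exec_skip]
      simp only [reg_setReg, Nat.reduceEqDiff, if_true, if_false, h310, hm₃]
      have hP : (∀ y' < y + 1, P x y') ↔ (∀ y' < y, P x y') ∧ P x y := by
        simp only [Nat.lt_succ_iff_lt_or_eq, or_imp, forall_and, forall_eq]
      rw [hP]
      split_ifs with h0
      · simp only [h0, P, ne_eq, not_true, false_imp_iff, and_true]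
        exact ⟨by omega, by omega, h37⟩
      · refine (exec_checkEdge _ (n := n) ?_).imp ?_
        · intro z
          simp only [reg_setReg, mem_setReg, Nat.reduceEqDiff, if_false, hm₃,
            r₃ 2 (by simp), r₂ 2 (by simp), r₁ 2 (by simp), r₃ 0 (by simp), r₂ 0 (by simp),
            r₁ 0 (by simp)]
          obtain ⟨j, hj, h⟩ := exists_stepFun_eq (fun i => s.mem (s.reg 0 + i)) z hk
          rw [h]
          exact hM _ (by omega)
        · rintro s₄ t₄ hf₄ ⟨ht₄, h₄⟩
          have h410 := hf₄.1 10 rfl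
          simp only [reg_setReg, mem_setReg, Nat.reduceEqDiff, if_false, if_true, hm₃, h310, hy9,
            r₃ 2 (by simp), r₂ 2 (by simp), r₁ 2 (by simp), r₃ 0 (by simp), r₂ 0 (by simp),
            r₁ 0 (by simp), r₃ 1 (by simp), r₂ 1 (by simp), r₁ 1 (by simp),
            r₃ 3 (by simp), r₂ 3 (by simp), r₁ 3 (by simp), r₃ 6 (by simp), r₂ 6 (by simp),
            r₃ 8 (by simp), hx8, h6, h37] at h₄ ht₄ h410
          refine ⟨by omega, by omega, ?_⟩
          rw [h₄]
          simp only [P, ne_eq, h0, not_false_eq_true, true_imp_iff, and_assoc, ← hn]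
    · simp [h10]
    · rintro s₃ t₃ hf₃ ⟨ht₃, h310, h37⟩
      have hP : (∀ x' < x + 1, ∀ y < n, P x' y) ↔ (∀ x' < x, ∀ y < n, P x' y) ∧ ∀ y < n, P x y := by
        simp only [Nat.lt_succ_iff_lt_or_eq, or_imp, forall_and, forall_eq]
      refine ⟨ht₃, by rw [h310]; ring, ?_⟩
      rw [h37, h27, hP, and_assoc]
  · simp [reg_setReg, r₁]
  · rintro s₂ t₂ - ⟨ht₂, -, h27⟩
    refine ⟨?_, ?_⟩
    · simp only [checkTime]
      rw [show n * (26 * s.reg 2 + 5 * n + 44) + 3 + 4 = n * (26 * s.reg 2 + 5 * n + 44) + 7 by ring]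
        at ht₂
      omega
    · rw [h27, h7]
      rfl

/-- Increase the number with the base `reg 1` digits stored in the `reg 4` cells from the address
`reg 0` on; `reg 21` is the carry. -/
def increment : RAMProg :=
  .seq (.const 21 1) <| .seq (mov 16 0) <| forLoop 15 14 4 <|
    .seq (.load 17 16) <| .seq (.add 17 17 21) <| .seq (.const 21 0) <| .seq (.sub 18 1 17) <|
    .seq (.ite 18 .skip (.seq (.const 17 0) (.const 21 1))) <|
    .seq (.store 16 17) <| .seq (.const 19 1) (.add 16 16 19)

/-- The memory `M` with the `m` base `n` digits of `N` stored from the address `B` on. -/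
def withDigits (M : ℕ → ℕ) (B n m N : ℕ) : ℕ → ℕ :=
  fun a => if B ≤ a ∧ a < B + m then N / n ^ (a - B) % n else M a

/-- School addition of one: a carry enters position `i` exactly when all lower digits are `n - 1`,
that is, when `n ^ i ∣ N + 1`. The second part says when the carry is passed on. -/
theorem digit_succ {n : ℕ} (hn : 1 ≤ n) (N i : ℕ) :
    (N + 1) / n ^ i % n =
      (if n ≤ N / n ^ i % n + (if n ^ i ∣ N + 1 then 1 else 0) then 0
        else N / n ^ i % n + (if n ^ i ∣ N + 1 then 1 else 0)) ∧
    (n ^ (i + 1) ∣ N + 1 ↔ n ≤ N / n ^ i % n + (if n ^ i ∣ N + 1 then 1 else 0)) := by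
  have hpos : 0 < n ^ i := Nat.pow_pos hn
  rw [Nat.succ_div]
  have hlt := Nat.mod_lt (N / n ^ i) hn
  split_ifs with h1 h2 h2
  · obtain ⟨q, hq⟩ := h1
    have hq' : N / n ^ i + 1 = q := by
      rw [← Nat.succ_div_of_dvd ⟨q, hq⟩, hq, Nat.mul_div_cancel_left _ hpos]
    have hdvd : n ^ (i + 1) ∣ N + 1 ↔ n ∣ q := by
      rw [hq, pow_succ, Nat.mul_dvd_mul_iff_left hpos]
    have h0 : (N / n ^ i + 1) % n = 0 := by
      rw [Nat.add_mod, show N / n ^ i % n = n - 1 by omega]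
      rcases Nat.lt_or_ge 1 n with h | h
      · rw [Nat.mod_eq_of_lt h, show n - 1 + 1 = n by omega, Nat.mod_self]
      · rw [show n = 1 by omega]
    refine ⟨h0, ?_⟩
    rw [hdvd, ← hq', Nat.dvd_iff_mod_eq_zero]
    exact ⟨fun _ => h2, fun _ => h0⟩
  · obtain ⟨q, hq⟩ := h1
    have hq' : N / n ^ i + 1 = q := by
      rw [← Nat.succ_div_of_dvd ⟨q, hq⟩, hq, Nat.mul_div_cancel_left _ hpos]
    have hdvd : n ^ (i + 1) ∣ N + 1 ↔ n ∣ q := by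
      rw [hq, pow_succ, Nat.mul_dvd_mul_iff_left hpos]
    have h0 : (N / n ^ i + 1) % n = N / n ^ i % n + 1 := by
      rw [Nat.add_mod, Nat.mod_eq_of_lt (show 1 < n by omega), Nat.mod_eq_of_lt (by omega)]
    refine ⟨h0, ?_⟩
    rw [hdvd, ← hq', Nat.dvd_iff_mod_eq_zero, h0]
    omega
  · omega
  · refine ⟨by simp, ⟨fun h => absurd (dvd_trans (pow_dvd_pow n (by omega)) h) h1, fun h => ?_⟩⟩
    omega

/-- During the run, cells before the pointer hold the digits of `N + 1` and the others still those
of `N`. The carry left at the end reports that the counter has wrapped around, which is the stop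
signal of `search`. -/
theorem exec_increment (s : RAMState) {M : ℕ → ℕ} {N : ℕ} (hn : 1 ≤ s.reg 1)
    (hs : s.mem = withDigits M (s.reg 0) (s.reg 1) (s.reg 4) N) :
    Exec increment s fun s' t => t ≤ s.reg 4 * 14 + 6 ∧
      s'.mem = withDigits M (s.reg 0) (s.reg 1) (s.reg 4) (N + 1) ∧
      s'.reg 21 = if s.reg 1 ^ s.reg 4 ∣ N + 1 then 1 else 0 := by
  set n := s.reg 1 with hn1
  set B := s.reg 0 with hB
  set m := s.reg 4 with hm4
  rw [increment, exec_seq, exec_const, exec_seq, exec_mov (by decide)]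
  refine (exec_forLoop (T := 10) (N := m)
    (fun j s' => s'.reg 16 = B + j ∧ s'.reg 21 = (if n ^ j ∣ N + 1 then 1 else 0) ∧
      ∀ a, s'.mem a = if a < B + j then withDigits M B n m (N + 1) a else withDigits M B n m N a)
    (by decide) (by decide) (by decide) rfl rfl (by simp [reg_setReg, hm4]) ?_ ?_ ?_).imp ?_
  · intro j s' v w h
    simpa [reg_setReg, mem_setReg] using h
  · rintro j s₁ hj hf hi ⟨h16, h21, hmem⟩
    have h1 := hf.1 1 rfl
    simp only [reg_setReg, Nat.reduceEqDiff, OfNat.one_ne_ofNat, if_false, ← hn1] at h1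
    obtain ⟨hd, hc⟩ := digit_succ hn N j
    have hw : ∀ N, withDigits M B n m N (B + j) = N / n ^ j % n := by
      intro N
      simp [withDigits, hj]
    have hload : s₁.mem (B + j) = N / n ^ j % n := by
      rw [hmem, if_neg (by omega), hw]
    simp only [exec_seq, exec_load, exec_const, exec_add, exec_sub, exec_ite, exec_skip, exec_store]
    simp only [reg_setReg, mem_setReg, reg_setMem, mem_setMem, Nat.reduceEqDiff,
      OfNat.one_ne_ofNat, if_true, if_false, h16, h1, hload, h21, Nat.sub_eq_zero_iff_le, hc]
    split_ifs at hd ⊢ <;> refine ⟨by simp, by omega, rfl, fun a => ?_⟩ <;>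
      rcases lt_trichotomy a (B + j) with h | rfl | h
    all_goals
      first
      | (rw [if_neg (by omega), hmem, if_pos h, if_pos (by omega)])
      | (rw [if_pos rfl, if_pos (by omega), hw, hd])
      | (rw [if_neg (by omega), hmem, if_neg (by omega), if_neg (by omega)])
  · simp only [reg_setReg, mem_setReg]
    refine ⟨by simp [hB], by simp, fun a => ?_⟩
    rw [hs]
    split_ifs with h
    · have : ¬ (B ≤ a ∧ a < B + m) := by omega
      simp [withDigits, this]
    · rfl
  · rintro s' t - ⟨ht, -, h21, hmem⟩
    refine ⟨by omega, ?_, h21⟩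
    funext a
    rw [hmem]
    split_ifs with h
    · rfl
    · have : ¬ (B ≤ a ∧ a < B + m) := by omega
      simp [withDigits, this]

/-- Apply `checkHom` to all sequences of `reg 4` numbers below `reg 1`; `reg 20` tells whether one
of them passes. -/
def search : RAMProg :=
  .seq (.const 20 0) <| .seq (.const 22 1) <| .loop 22 <|
    .seq checkHom <| .seq (.ite 7 (.const 20 1) .skip) <| .seq increment <|
    .seq (.const 22 1) (.sub 22 22 21)

theorem exec_search (s : RAMState) (hn : 1 ≤ s.reg 1) (hk : 1 ≤ s.reg 2)
    (hm : s.reg 4 = 2 * s.reg 2 + 2) (hzero : ∀ i < s.reg 4, s.mem (s.reg 0 + i) = 0) :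
    Exec search s fun s' t =>
      t ≤ s.reg 1 ^ s.reg 4 * (checkTime (s.reg 1) (s.reg 2) + s.reg 4 * 14 + 11) + 3 ∧
      (s'.reg 20 = 0 ∨ s'.reg 20 = 1) ∧
      (s'.reg 20 = 1 ↔ ∃ N < s.reg 1 ^ s.reg 4,
        HomOK (withDigits s.mem (s.reg 0) (s.reg 1) (s.reg 4) N) (s.reg 0) (s.reg 1) (s.reg 2)
          (s.reg 3) (s.reg 5)) := by
  set n := s.reg 1 with hn1
  set m := s.reg 4 with hm4
  have hpos : 0 < n ^ m := Nat.pow_pos hn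
  let D := fun N => withDigits s.mem (s.reg 0) n m N
  let P := fun N => HomOK (D N) (s.reg 0) n (s.reg 2) (s.reg 3) (s.reg 5)
  rw [search, exec_seq, exec_const, exec_seq, exec_const]
  refine (exec_loop (T := checkTime n (s.reg 2) + m * 14 + 10)
    (fun j s' => j ≤ n ^ m ∧ s'.mem = D j ∧ (∀ r < 6, s'.reg r = s.reg r) ∧
      s'.reg 22 = (if j = n ^ m then 0 else 1) ∧ (s'.reg 20 = 0 ∨ s'.reg 20 = 1) ∧
      (s'.reg 20 = 1 ↔ ∃ N < j, P N)) (n ^ m) ?_ ?_ ?_).imp ?_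
  · rintro j s' ⟨-, -, -, h, -⟩
    simp [h]
  · rintro j s₁ hj ⟨-, hmem, hr, -, h20, hP⟩
    rw [exec_seq]
    refine (exec_checkHom s₁ ?_ ?_).imp ?_
    · rwa [hr 2 (by decide)]
    · intro i hi
      rw [hr 2 (by decide), ← hm] at hi
      rw [hmem, hr 0 (by decide), hr 1 (by decide)]
      simp only [D, withDigits]
      rw [if_pos (by omega)]
      exact (Nat.mod_lt _ hn).le
    rintro s₂ t₂ hf₂ ⟨ht₂, h7⟩
    have hm₂ : s₂.mem = D j := (hf₂.2 rfl).trans hmem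
    have r₂ : ∀ r < 6, s₂.reg r = s.reg r := by
      intro r h
      rw [← hr r h]
      apply hf₂.1
      interval_cases r <;> rfl
    have h20₂ : s₂.reg 20 = s₁.reg 20 := hf₂.1 20 rfl
    rw [hmem, hr 0 (by decide), hr 1 (by decide), hr 2 (by decide), hr 3 (by decide),
      hr 5 (by decide)] at h7
    rw [hr 1 (by decide), hr 2 (by decide), ← hn1] at ht₂
    have hite : Exec (.ite 7 (.const 20 1) .skip) s₂ fun s' t => t ≤ 2 ∧
        (s'.reg 20 = 0 ∨ s'.reg 20 = 1) ∧ (s'.reg 20 = 1 ↔ ∃ N < j + 1, P N) := by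
      have hsplit : (∃ N < j + 1, P N) ↔ (∃ N < j, P N) ∨ P j := by
        simp only [Nat.lt_succ_iff_lt_or_eq, or_and_right, exists_or, exists_eq_left]
      simp only [exec_ite, exec_skip, exec_const, hsplit]
      split_ifs with h
      · have : ¬ P j := fun h' => h7.2 h' h
        simp only [h20₂, this, or_false]
        exact ⟨by simp, h20, hP⟩
      · have : P j := h7.1 h
        simp [reg_setReg, this]
    rw [exec_seq]
    refine hite.imp ?_
    rintro s₃ t₃ hf₃ ⟨ht₃, h20₃, hP₃⟩
    have hm₃ : s₃.mem = D j := (hf₃.2 rfl).trans hm₂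
    have r₃ : ∀ r < 6, s₃.reg r = s.reg r := by
      intro r h
      rw [← r₂ r h]
      apply hf₃.1
      interval_cases r <;> rfl
    rw [exec_seq]
    refine (exec_increment s₃ (M := s.mem) (N := j) ?_ ?_).imp ?_
    · rwa [r₃ 1 (by decide)]
    · rw [hm₃, r₃ 0 (by decide), r₃ 1 (by decide), r₃ 4 (by decide)]
    rintro s₄ t₄ hf₄ ⟨ht₄, hm₄, h21⟩
    have r₄ : ∀ r < 6, s₄.reg r = s.reg r := by
      intro r h
      rw [← r₃ r h]
      apply hf₄.1
      interval_cases r <;> rfl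
    have h20₄ : s₄.reg 20 = s₃.reg 20 := hf₄.1 20 rfl
    rw [r₃ 0 (by decide), r₃ 1 (by decide), r₃ 4 (by decide)] at hm₄
    rw [r₃ 1 (by decide), r₃ 4 (by decide)] at h21
    rw [r₃ 4 (by decide)] at ht₄
    simp only [exec_seq, exec_const, exec_sub, reg_setReg, mem_setReg, Nat.reduceEqDiff, if_true,
      if_false, h21, h20₄]
    refine ⟨by omega, by omega, hm₄, ?_, ?_, h20₃, hP₃⟩
    · intro r h
      rw [if_neg (by omega), if_neg (by omega), r₄ r h]
    -- As `0 < j + 1 ≤ n ^ m`, the carry appears in the last round and in no earlier one.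
    · have : n ^ m ∣ j + 1 ↔ j + 1 = n ^ m :=
        ⟨fun h => le_antisymm hj (Nat.le_of_dvd (by omega) h), fun h => h ▸ dvd_rfl⟩
      simp only [← hn1, ← hm4, this]
      split_ifs <;> rfl
  · refine ⟨by omega, ?_, ?_, ?_, ?_, ?_⟩
    · funext a
      simp only [D, withDigits, mem_setReg]
      split_ifs with h
      · rw [Nat.zero_div, Nat.zero_mod, show a = s.reg 0 + (a - s.reg 0) by omega]
        exact hzero _ (by omega)
      · rfl
    · intro r h
      simp only [reg_setReg]
      rw [if_neg (by omega), if_neg (by omega)]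
    · simp [reg_setReg, hpos.ne]
    · simp [reg_setReg]
    · simp [reg_setReg]
  · rintro s' t - ⟨ht, -, -, -, -, h20, hP⟩
    refine ⟨?_, h20, hP⟩
    rw [show checkTime n (s.reg 2) + m * 14 + 10 + 1 = checkTime n (s.reg 2) + m * 14 + 11 by ring]
      at ht
    omega

end RAMProg

/-! ### Digit sequences versus ordered endomorphisms with few values. -/

/-- Being a maximum, the step function ignores the order and repetition of the steps, so the list of
steps need be neither sorted nor free of duplicates. -/
theorem stepFun_eq {a : ℕ → ℕ} {x y k : ℕ} (h0 : a 3 ≤ y)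
    (hle : ∀ i < k, a (2 + 2 * i) ≤ x → a (3 + 2 * i) ≤ y)
    (hex : ∃ i < k, a (2 + 2 * i) ≤ x ∧ a (3 + 2 * i) = y) : stepFun a x k = y := by
  have hub : ∀ j ≤ k, stepFun a x j ≤ y := by
    intro j hj
    induction j with
    | zero => exact h0
    | succ j ih =>
      rw [stepFun]
      split_ifs with h
      · exact max_le (ih (by omega)) (hle j hj h)
      · exact ih (by omega)
  have hlb : ∀ j i, i < j → a (2 + 2 * i) ≤ x → a (3 + 2 * i) ≤ stepFun a x j := by
    intro j
    induction j with
    | zero => intro i hi; omega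
    | succ j ih =>
      intro i hi h
      rw [stepFun]
      rcases Nat.lt_succ_iff_lt_or_eq.1 hi with hi | rfl
      · split_ifs
        · exact le_max_of_le_left (ih i hi h)
        · exact ih i hi h
      · rw [if_pos h]
        exact le_max_right _ _
  obtain ⟨i, hi, h1, h2⟩ := hex
  exact le_antisymm (hub k le_rfl) (h2 ▸ hlb k i hi h1)

/-- A larger argument starts more steps. Every digit sequence thus decodes to a monotone map, and
only the edges have to be tested. -/
theorem stepFun_mono (a : ℕ → ℕ) (k : ℕ) : Monotone fun x => stepFun a x k := by
  intro x y hxy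
  induction k with
  | zero => exact le_rfl
  | succ k ih =>
    simp only [stepFun] at ih ⊢
    split_ifs with h1 h2 h2
    · exact max_le_max ih le_rfl
    · omega
    · exact le_max_of_le_left ih
    · exact ih

theorem exists_digits_eq {n : ℕ} (m : ℕ) (a : ℕ → ℕ) (ha : ∀ i < m, a i < n) :
    ∃ N < n ^ m, ∀ i < m, N / n ^ i % n = a i := by
  induction m generalizing a with
  | zero => exact ⟨0, by simp, by simp⟩
  | succ m ih =>
    obtain ⟨N, hN, h⟩ := ih (fun i => a (i + 1)) fun i hi => ha _ (by omega)
    have h0 := ha 0 (by omega)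
    refine ⟨n * N + a 0, ?_, ?_⟩
    · calc n * N + a 0 < n * N + n := by omega
        _ = n * (N + 1) := by ring
        _ ≤ n * n ^ m := Nat.mul_le_mul_left _ hN
        _ = n ^ (m + 1) := by ring
    · rintro (_ | i) hi
      · simp [Nat.mod_eq_of_lt h0]
      · rw [pow_succ', ← Nat.div_div_eq_div_mul, Nat.mul_add_div (by omega),
          Nat.div_eq_of_lt h0, add_zero]
        exact h i (by omega)

theorem mul_add_inj {n x y x' y' : ℕ} (hy : y < n) (hy' : y' < n)
    (h : x * n + y = x' * n + y') : x = x' ∧ y = y' := by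
  have hn : 0 < n := by omega
  have h1 := congrArg (· / n) h
  have h2 := congrArg (· % n) h
  simp only [Nat.mul_add_mod', Nat.mod_eq_of_lt hy, Nat.mod_eq_of_lt hy'] at h2
  simp only [mul_comm _ n, Nat.mul_add_div hn, Nat.div_eq_of_lt hy, Nat.div_eq_of_lt hy'] at h1
  exact ⟨by simpa using h1, h2⟩

/-- `G` has an ordered endomorphism with at most `k` vertices in its image; if `b` holds, then
moreover some edge of `G` is not the image of an edge. -/
def HasSmallEndo {V : Type*} [LinearOrder V] (G : SimpleGraph V) (k : ℕ) (b : Prop) : Prop :=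
  ∃ f : G →g G, Monotone f ∧ (Set.range f).ncard ≤ k ∧
    (b → ∃ u v, G.Adj u v ∧ ∀ x y, G.Adj x y → ¬ (f x = u ∧ f y = v))

/-- The adjacency matrix of `G` is stored from the address `off` on. -/
def StoresMatrix {n : ℕ} (M : ℕ → ℕ) (off : ℕ) (G : SimpleGraph (Fin n)) : Prop :=
  ∀ x y : Fin n, M (off + x * n + y) ≠ 0 ↔ G.Adj x y

theorem matrixAddr_lt {n x y : ℕ} (off : ℕ) (hx : x < n) (hy : y < n) :
    off + x * n + y < off + n * n := by
  nlinarith [Nat.mul_le_mul_right n hx]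

theorem homOK_iff {n k off B b : ℕ} {M : ℕ → ℕ} {G : SimpleGraph (Fin n)} (hoff : 1 ≤ off)
    (hM : StoresMatrix M off G) {f : Fin n → Fin n}
    (hf : ∀ x : Fin n, stepFun (fun i => M (B + i)) x k = f x) {u v : Fin n}
    (hu : M B = u) (hv : M (B + 1) = v) :
    RAMProg.HomOK M B n k off b ↔
      (b ≠ 0 → G.Adj u v) ∧
      ∀ x y, G.Adj x y → G.Adj (f x) (f y) ∧ (b ≠ 0 → ¬ (f x = u ∧ f y = v)) := by
  have h1 : (b = 0 ∨ M (RAMProg.forbiddenAddr M B n off b) ≠ 0) ↔ (b ≠ 0 → G.Adj u v) := by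
    by_cases hb : b = 0
    · simp [hb]
    · simp only [RAMProg.forbiddenAddr, hb, if_false, hu, hv, false_or, hM u v]
      simp [hb]
  have h2 : ∀ x y : Fin n, RAMProg.EdgeOK M B n k off (RAMProg.forbiddenAddr M B n off b) x y ↔
      G.Adj (f x) (f y) ∧ (b ≠ 0 → ¬ (f x = u ∧ f y = v)) := by
    intro x y
    simp only [RAMProg.EdgeOK, hf, hM (f x) (f y)]
    refine and_congr_right fun _ => ?_
    by_cases hb : b = 0
    -- Without a forbidden edge the stored address is `0`, which is never that of a matrix entry
    -- because `off ≥ 1`.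
    · simp only [RAMProg.forbiddenAddr, hb, if_true]
      simp
      omega
    · simp only [RAMProg.forbiddenAddr, hb, if_false, hu, hv, ne_eq, not_false_eq_true,
        true_imp_iff, not_iff_not]
      constructor
      · intro h
        obtain ⟨h3, h4⟩ := mul_add_inj (f y).2 v.2 (x := f x) (x' := u) (by omega)
        exact ⟨Fin.ext h3, Fin.ext h4⟩
      · rintro ⟨rfl, rfl⟩
        rfl
  rw [RAMProg.HomOK, h1]
  refine and_congr_right fun _ => ⟨fun h x y hxy => ?_, fun h x hx y hy hxy => ?_⟩
  · exact (h2 x y).1 (h x x.2 y y.2 ((hM x y).2 hxy))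
  · exact (h2 ⟨x, hx⟩ ⟨y, hy⟩).2 (h _ _ ((hM ⟨x, hx⟩ ⟨y, hy⟩).1 hxy))

/-- The values of `f` can be listed with the value at zero first. -/
theorem exists_list_values {n k : ℕ} (hn : 0 < n) (hk : 1 ≤ k) (f : Fin n → Fin n)
    (hf : (Set.range f).ncard ≤ k) :
    ∃ v : ℕ → Fin n, v 0 = f ⟨0, hn⟩ ∧ (∀ x, ∃ i < k, v i = f x) ∧ ∀ i, v i ∈ Set.range f := by
  classical
  set z : Fin n := ⟨0, hn⟩
  let S : Finset (Fin n) := Finset.univ.image f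
  have hS : S.card ≤ k := by
    rw [← Set.ncard_coe_finset]
    simpa [S] using hf
  -- The value at the least vertex comes first because the first height is the base value of
  -- `stepFun`; it also pads the list if there are fewer than `k` values.
  let L := f z :: (S.erase (f z)).toList
  have hz : f z ∈ S := Finset.mem_image_of_mem _ (Finset.mem_univ _)
  have hlen : L.length ≤ k := by
    simp only [L, List.length_cons, Finset.length_toList, Finset.card_erase_of_mem hz]
    omega
  have hL : ∀ y, y ∈ L ↔ y ∈ Set.range f := by
    intro y
    simp only [L, List.mem_cons, Finset.mem_toList, Finset.mem_erase, S, Finset.mem_image,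
      Finset.mem_univ, true_and, Set.mem_range]
    constructor
    · rintro (rfl | ⟨-, h⟩)
      exacts [⟨z, rfl⟩, h]
    · intro h
      by_cases hy : y = f z
      exacts [.inl hy, .inr ⟨hy, h⟩]
  refine ⟨fun i => L.getD i (f z), rfl, fun x => ?_, fun i => ?_⟩
  · obtain ⟨i, hi, h⟩ := List.getElem_of_mem ((hL (f x)).2 ⟨x, rfl⟩)
    exact ⟨i, by omega, (List.getD_eq_getElem _ _ hi).trans h⟩
  · rw [← hL]
    show L.getD i (f z) ∈ L
    rcases Nat.lt_or_ge i L.length with h | h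
    · rw [List.getD_eq_getElem _ _ h]
      exact List.getElem_mem h
    · rw [List.getD_eq_default _ _ h, hL]
      exact ⟨z, rfl⟩

/-- The digits lie behind the matrix (`hB`), so every candidate sees the same graph. For the
converse, a monotone `f` is encoded by its values as heights and the least vertices of their fibres
as thresholds. -/
theorem exists_homOK_iff {n k off B b : ℕ} {M : ℕ → ℕ} {G : SimpleGraph (Fin n)}
    (hn : 1 ≤ n) (hk : 1 ≤ k) (hoff : 1 ≤ off) (hM : StoresMatrix M off G)
    (hB : off + n * n ≤ B) :
    (∃ N < n ^ (2 * k + 2),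
      RAMProg.HomOK (RAMProg.withDigits M B n (2 * k + 2) N) B n k off b) ↔
      HasSmallEndo G k (b ≠ 0) := by
  have hD : ∀ N, StoresMatrix (RAMProg.withDigits M B n (2 * k + 2) N) off G := by
    intro N x y
    have := matrixAddr_lt off x.2 y.2
    rw [RAMProg.withDigits, if_neg (by omega)]
    exact hM x y
  have hdig : ∀ N, ∀ i < 2 * k + 2,
      RAMProg.withDigits M B n (2 * k + 2) N (B + i) = N / n ^ i % n := by
    intro N i hi
    simp [RAMProg.withDigits, hi]
  constructor
  · rintro ⟨N, -, h⟩
    set D := RAMProg.withDigits M B n (2 * k + 2) N with hDdef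
    have hlt : ∀ i < 2 * k + 2, D (B + i) < n := by
      intro i hi
      rw [hDdef, hdig N i hi]
      exact Nat.mod_lt _ hn
    have hval : ∀ x, ∃ j < k, stepFun (fun i => D (B + i)) x k = D (B + (3 + 2 * j)) :=
      fun x => exists_stepFun_eq _ x hk
    have hFlt : ∀ x, stepFun (fun i => D (B + i)) x k < n := by
      intro x
      obtain ⟨j, hj, h⟩ := hval x
      rw [h]
      exact hlt _ (by omega)
    let f : Fin n → Fin n := fun x => ⟨_, hFlt x⟩
    obtain ⟨h1, h2⟩ := (homOK_iff hoff (hD N) (f := f) (u := ⟨_, hlt 0 (by omega)⟩)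
      (v := ⟨_, hlt 1 (by omega)⟩) (fun _ => rfl) rfl rfl).1 h
    refine ⟨⟨f, fun {x y} hxy => (h2 x y hxy).1⟩, fun x y hxy => stepFun_mono _ k hxy, ?_,
      fun hb => ⟨_, _, h1 hb, fun x y hxy => (h2 x y hxy).2 hb⟩⟩
    show (Set.range f).ncard ≤ k
    rw [← Set.ncard_image_of_injective _ Fin.val_injective]
    refine (Set.ncard_le_ncard (t := ((Finset.range k).image fun j => D (B + (3 + 2 * j)) :
      Finset ℕ)) ?_ (Finset.finite_toSet _)).trans ?_
    · rintro _ ⟨_, ⟨x, rfl⟩, rfl⟩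
      obtain ⟨j, hj, h⟩ := hval x
      simp only [Finset.coe_image, Set.mem_image, Finset.mem_coe, Finset.mem_range]
      exact ⟨j, hj, h.symm⟩
    · rw [Set.ncard_coe_finset]
      exact Finset.card_image_le.trans (by simp)
  · rintro ⟨f, hmono, hcard, havoid⟩
    obtain ⟨v, hv0, hvex, hvr⟩ := exists_list_values hn hk f hcard
    have hmin : ∀ i, ∃ x, f x = v i ∧ ∀ y, f y = v i → x ≤ y := by
      intro i
      obtain ⟨x, hx, h⟩ := wellFounded_lt.has_min {x | f x = v i} (hvr i)
      exact ⟨x, hx, fun y hy => not_lt.1 (h y hy)⟩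
    choose c hc hcmin using hmin
    obtain ⟨p, q, hpq⟩ : ∃ p q : Fin n, b ≠ 0 → G.Adj p q ∧
        ∀ x y, G.Adj x y → ¬ (f x = p ∧ f y = q) := by
      by_cases hb : b = 0
      -- With no edge to avoid, any two digits will do.
      · exact ⟨⟨0, hn⟩, ⟨0, hn⟩, fun h => absurd hb h⟩
      · obtain ⟨p, q, h⟩ := havoid hb
        exact ⟨p, q, fun _ => h⟩
    let a : ℕ → Fin n := fun i => if i = 0 then p else if i = 1 then q else
      if i % 2 = 0 then c ((i - 2) / 2) else v ((i - 3) / 2)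
    obtain ⟨N, hN, hdigN⟩ := exists_digits_eq (n := n) (2 * k + 2) (fun i => a i)
      fun i _ => (a i).2
    refine ⟨N, hN, ?_⟩
    set D := RAMProg.withDigits M B n (2 * k + 2) N with hDdef
    have hDa : ∀ i < 2 * k + 2, D (B + i) = a i := fun i hi => by
      rw [hDdef, hdig N i hi, hdigN i hi]
    have hDc : ∀ i < k, D (B + (2 + 2 * i)) = c i := by
      intro i hi
      rw [hDa _ (by omega)]
      simp only [a]
      rw [if_neg (by omega), if_neg (by omega), if_pos (by omega)]
      congr 3
      omega
    have hDv : ∀ i < k, D (B + (3 + 2 * i)) = v i := by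
      intro i hi
      rw [hDa _ (by omega)]
      simp only [a]
      rw [if_neg (by omega), if_neg (by omega), if_neg (by omega)]
      congr 3
      omega
    refine (homOK_iff (M := D) hoff (hD N) (f := f) (u := p) (v := q) ?_ ?_ ?_).2
      ⟨fun hb => (hpq hb).1, fun x y hxy => ⟨f.map_rel hxy, fun hb => (hpq hb).2 x y hxy⟩⟩
    · intro x
      refine stepFun_eq ?_ ?_ ?_
      · show D (B + (3 + 2 * 0)) ≤ _
        rw [hDv 0 hk, hv0]
        exact hmono (Fin.mk_le_of_le_val (Nat.zero_le _))
      · intro i hi h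
        rw [hDc i hi] at h
        rw [hDv i hi]
        rw [← hc i]
        exact hmono h
      -- The step whose height is `f x` starts at the least vertex of that fibre, hence not after
      -- `x`.
      · obtain ⟨i, hi, h⟩ := hvex x
        exact ⟨i, hi, by rw [hDc i hi]; exact hcmin i x h.symm, by rw [hDv i hi, h]⟩
    · exact hDa 0 (by omega)
    · exact hDa 1 (by omega)

/-! ## Cores and small endomorphisms -/

section Core
variable {V : Type*} [LinearOrder V]

theorem intervalColorable_of_monotone {G : SimpleGraph V} {k : ℕ} (c : V → Fin k)
    (hc : Monotone c) (hG : ∀ x y, G.Adj x y → c x ≠ c y) : IntervalColorable G k :=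
  ⟨c, fun _ => ⟨Set.OrdConnected.preimage_mono Set.ordConnected_singleton hc,
    fun x hx y hy _ hxy => hG x y hxy (Eq.trans hx (Eq.symm hy))⟩⟩

/-- The fibres of an ordered homomorphism are independent intervals, indexed by the vertices of the
target. -/
theorem orderedChromaticNumber_le_of_hasOrderedHom [Finite V] {G : SimpleGraph V}
    {H : G.Subgraph} (h : HasOrderedHom G H.coe) :
    orderedChromaticNumber G ≤ H.verts.ncard := by
  classical
  obtain ⟨f, hf⟩ := h
  have : Fintype H.verts := Fintype.ofFinite _
  let e := Fintype.orderIsoFinOfCardEq H.verts rfl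
  rw [← Nat.card_coe_set_eq, Nat.card_eq_fintype_card]
  refine Nat.sInf_le (intervalColorable_of_monotone (fun x => e.symm (f x))
    (e.symm.monotone.comp hf) fun x y hxy heq => ?_)
  exact (f.map_rel hxy).ne (e.symm.injective heq)

/-- A subgraph that is minimal among those to which `G` maps is a core. -/
theorem isOrderedCore_of_minimal {G : SimpleGraph V} {H : G.Subgraph}
    (h : HasOrderedHom G H.coe) (hmin : ∀ K ≤ H, HasOrderedHom G K.coe → K = H) :
    IsOrderedCore H.coe := by
  obtain ⟨g, hg⟩ := h
  rintro K hK ⟨f, hf, -⟩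
  refine hK (SimpleGraph.Subgraph.coeSubgraph_injective H ?_)
  have htop : SimpleGraph.Subgraph.coeSubgraph (⊤ : H.coe.Subgraph) = H := by
    simp
  rw [htop]
  -- Composing with a retraction of `H` onto `K` maps `G` to `K`, now viewed as a subgraph of `G`
  -- below `H`.
  refine hmin _ (SimpleGraph.Subgraph.coeSubgraph_le K) ?_
  let e : K.coe →g (SimpleGraph.Subgraph.coeSubgraph K).coe :=
    { toFun := fun v => ⟨v.1.1, by simp⟩
      map_rel' := fun {a b} hab => by
        exact (SimpleGraph.Subgraph.coeSubgraph_adj K _ _).2 ⟨a.1.2, b.1.2, hab⟩ }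
  exact ⟨e.comp (f.comp g), fun x y hxy => hf (hg hxy)⟩

/-- A minimal target inside the image of a small endomorphism is a core with at most the chromatic
number of vertices; it cannot have fewer, since every target has at least that many. -/
theorem coreHasCard_iff [Finite V] (G : SimpleGraph V) :
    CoreHasCard G (orderedChromaticNumber G) ↔
      HasSmallEndo G (orderedChromaticNumber G) False := by
  constructor
  · rintro ⟨H, ⟨-, f, hf⟩, hcard⟩
    refine ⟨H.hom.comp f, hf, ?_, False.elim⟩
    rw [← hcard]
    refine Set.ncard_le_ncard ?_
    rintro _ ⟨x, rfl⟩
    exact (f x).2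
  · rintro ⟨f, hf, hcard, -⟩
    let H₀ : G.Subgraph := (⊤ : G.Subgraph).map f
    have hverts : H₀.verts = Set.range f := by simp [H₀]
    have h₀ : HasOrderedHom G H₀.coe :=
      ⟨⟨fun x => ⟨f x, by simp [hverts]⟩, fun {a b} hab => ⟨a, b, hab, rfl, rfl⟩⟩,
        fun x y hxy => hf hxy⟩
    obtain ⟨H, ⟨hH₀, hH⟩, hmin⟩ := (wellFounded_lt (α := G.Subgraph)).has_min
      {H | H ≤ H₀ ∧ HasOrderedHom G H.coe} ⟨H₀, le_rfl, h₀⟩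
    refine ⟨H, ⟨isOrderedCore_of_minimal hH fun K hK hGK => ?_, hH⟩, le_antisymm ?_
      (orderedChromaticNumber_le_of_hasOrderedHom hH)⟩
    · exact hK.eq_of_not_lt (hmin K ⟨hK.trans hH₀, hGK⟩)
    · exact (Set.ncard_le_ncard (hverts ▸ hH₀.1)).trans hcard

/-- For `k` below the order of `G`, any `k` vertices containing the image induce a proper subgraph.
For equality, properness means a missing edge, and deleting one edge that is not hit gives the
target. -/
theorem exists_proper_subgraph_iff [Finite V] (G : SimpleGraph V) {k : ℕ} (hk : k ≤ Nat.card V) :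
    (∃ H : G.Subgraph, H ≠ ⊤ ∧ H.verts.ncard = k ∧ HasOrderedHom G H.coe) ↔
      HasSmallEndo G k (k = Nat.card V) := by
  constructor
  · rintro ⟨H, hne, hcard, f, hf⟩
    refine ⟨H.hom.comp f, hf, ?_, fun hkV => ?_⟩
    · rw [← hcard]
      refine Set.ncard_le_ncard ?_
      rintro _ ⟨x, rfl⟩
      exact (f x).2
    · by_contra! hcon
      refine hne (SimpleGraph.Subgraph.ext ?_ ?_)
      · refine Set.eq_univ_of_univ_subset ?_
        rw [Set.eq_of_subset_of_ncard_le (Set.subset_univ H.verts) (by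
          rw [Set.ncard_univ, hcard, hkV])]
      · ext u v
        refine ⟨fun h => h.adj_sub, fun h => ?_⟩
        obtain ⟨x, y, hxy, rfl, rfl⟩ := hcon u v h
        exact f.map_rel hxy
  · rintro ⟨f, hf, hcard, havoid⟩
    rcases hk.lt_or_eq with hlt | heq
    · obtain ⟨S, hfS, -, hS⟩ := Set.exists_subsuperset_card_eq (Set.subset_univ (Set.range f))
        hcard (by rwa [Set.ncard_univ])
      refine ⟨(⊤ : G.Subgraph).induce S, fun h => ?_, hS, ?_⟩
      · have h1 : S = Set.univ := congrArg SimpleGraph.Subgraph.verts h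
        rw [h1, Set.ncard_univ] at hS
        omega
      · refine ⟨⟨fun x => ⟨f x, hfS ⟨x, rfl⟩⟩, fun {a b} hab => ?_⟩, fun x y hxy => hf hxy⟩
        exact ⟨hfS ⟨a, rfl⟩, hfS ⟨b, rfl⟩, f.map_rel hab⟩
    · obtain ⟨u, v, huv, h⟩ := havoid heq
      refine ⟨(⊤ : G.Subgraph).deleteEdges {s(u, v)}, fun htop => ?_, ?_, ?_⟩
      · have h1 : ((⊤ : G.Subgraph).deleteEdges {s(u, v)}).Adj u v := by
          rw [htop]
          exact huv
        simp at h1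
      · simp [Set.ncard_univ, heq]
      · refine ⟨⟨fun x => ⟨f x, by simp⟩, fun {a b} hab => ?_⟩, fun x y hxy => hf hxy⟩
        have h1 := h a b hab
        -- Only the ordered pair `(u, v)` is known to be avoided; the reversed edge handles `(v,
        -- u)`.
        have h2 := h b a hab.symm
        have h3 : G.Adj (f a) (f b) := f.map_rel hab
        simp only [SimpleGraph.Subgraph.coe_adj, SimpleGraph.Subgraph.deleteEdges_adj,
          SimpleGraph.Subgraph.top_adj, Set.mem_singleton_iff, Sym2.eq_iff]
        tauto

end Core

/-! ## The ordered chromatic number -/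

open Classical in
/-- The greedy partition of the vertices below `x` into independent intervals: the first vertex of
the last interval, and the number of intervals (at least one). -/
noncomputable def greedyIntervals (A : ℕ → ℕ → Prop) : ℕ → ℕ × ℕ
  | 0 => (0, 1)
  | x + 1 =>
    if ∃ y < x, (greedyIntervals A x).1 ≤ y ∧ A x y then (x, (greedyIntervals A x).2 + 1)
    else greedyIntervals A x

section Greedy
variable {A : ℕ → ℕ → Prop}

theorem greedyIntervals_mono (A : ℕ → ℕ → Prop) : Monotone fun x => (greedyIntervals A x).2 := by
  refine monotone_nat_of_le_succ fun x => ?_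
  simp only [greedyIntervals]
  split_ifs
  · exact Nat.le_succ _
  · exact le_rfl

theorem one_le_greedyIntervals (A : ℕ → ℕ → Prop) (x : ℕ) : 1 ≤ (greedyIntervals A x).2 :=
  greedyIntervals_mono A (Nat.zero_le x)

theorem greedyIntervals_fst_le (A : ℕ → ℕ → Prop) (x : ℕ) : (greedyIntervals A (x + 1)).1 ≤ x := by
  induction x with
  | zero => simp [greedyIntervals]
  | succ x ih =>
    rw [greedyIntervals]
    split_ifs
    · exact le_rfl
    · exact ih.trans (Nat.le_succ x)

/-- The state changes only when a new interval starts, and this raises the count. -/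
theorem greedyIntervals_eq_of_snd_eq {x y : ℕ} (hxy : x ≤ y)
    (h : (greedyIntervals A x).2 = (greedyIntervals A y).2) :
    greedyIntervals A x = greedyIntervals A y := by
  induction y, hxy using Nat.le_induction with
  | base => rfl
  | succ y hxy ih =>
    have h1 := greedyIntervals_mono A hxy
    simp only at h1
    rw [greedyIntervals] at h ⊢
    split_ifs at h ⊢
    · simp only at h
      omega
    · exact ih h

/-- The interval of vertex `x` is read off at index `x + 1`. If no interval started after `y` and
before `x`, then `y` lies in the current interval, and its adjacency to `x` starts a new one at `x`.
-/
theorem greedyIntervals_ne {x y : ℕ} (hyx : y < x) (hA : A x y) :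
    (greedyIntervals A (y + 1)).2 ≠ (greedyIntervals A (x + 1)).2 := by
  intro h
  have h1 := greedyIntervals_mono A (show y + 1 ≤ x from hyx)
  have h2 := greedyIntervals_mono A (show x ≤ x + 1 by omega)
  simp only at h1 h2
  have h3 := greedyIntervals_eq_of_snd_eq (A := A) (show y + 1 ≤ x from hyx) (by omega)
  have h4 := greedyIntervals_fst_le A y
  rw [h3] at h4 h
  rw [greedyIntervals, if_pos ⟨y, hyx, h4, hA⟩] at h
  simp at h

theorem orderedChromaticNumber_eq {n : ℕ} (G : SimpleGraph (Fin n)) (hn : 1 ≤ n)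
    (hA : ∀ x y : Fin n, A x y ↔ G.Adj x y) :
    orderedChromaticNumber G = (greedyIntervals A n).2 := by
  refine le_antisymm (Nat.sInf_le ?_) (le_csInf ?_ ?_)
  · have hlt : ∀ x : Fin n, (greedyIntervals A (x + 1)).2 - 1 < (greedyIntervals A n).2 := by
      intro x
      have h1 := greedyIntervals_mono A (show x.1 + 1 ≤ n from x.2)
      have h2 := one_le_greedyIntervals A (x + 1)
      simp only at h1
      omega
    refine intervalColorable_of_monotone (fun x => ⟨_, hlt x⟩) ?_ ?_
    · intro x y hxy
      have h1 := greedyIntervals_mono A (show x.1 + 1 ≤ y.1 + 1 from Nat.succ_le_succ hxy)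
      exact Nat.sub_le_sub_right h1 1
    · intro x y hxy heq
      have h1 : (greedyIntervals A (x + 1)).2 - 1 = (greedyIntervals A (y + 1)).2 - 1 :=
        congrArg Fin.val heq
      have h2 := one_le_greedyIntervals A (x + 1)
      have h3 := one_le_greedyIntervals A (y + 1)
      rcases lt_trichotomy x.1 y.1 with h | h | h
      · exact greedyIntervals_ne h ((hA y x).2 hxy.symm) (by omega)
      · exact hxy.ne (Fin.ext h)
      · exact greedyIntervals_ne h ((hA x y).2 hxy) (by omega)
  · exact ⟨n, intervalColorable_of_monotone id monotone_id fun x y hxy => hxy.ne⟩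
  -- Optimality: the first vertices of the greedy intervals get different colours. If an earlier one
  -- `s` had the colour of a new one `x`, then so would the neighbour `y` of `x` with `s ≤ y < x`,
  -- by convexity, against independence.
  · rintro k ⟨c, hc⟩
    have key : ∀ x ≤ n, (greedyIntervals A x).1 ≤ x ∧ ∃ S : Finset (Fin n),
        S.card = (greedyIntervals A x).2 ∧ (∀ s ∈ S, s.1 ≤ (greedyIntervals A x).1) ∧
        Set.InjOn c S := by
      intro x hx
      induction x with
      | zero => exact ⟨le_rfl, {⟨0, hn⟩}, by simp [greedyIntervals]⟩
      | succ x ih =>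
        obtain ⟨hst, S, hcard, hle, hinj⟩ := ih (by omega)
        rw [greedyIntervals]
        split_ifs with h
        · obtain ⟨y, hyx, hsty, hxy⟩ := h
          have hne : ∀ s ∈ S, c s ≠ c ⟨x, hx⟩ := by
            intro s hs heq
            have h1 : (⟨y, by omega⟩ : Fin n) ∈ c ⁻¹' {c ⟨x, hx⟩} :=
              (hc _).1.out (show s ∈ _ from heq) (show (⟨x, hx⟩ : Fin n) ∈ _ from rfl)
                ⟨(hle s hs).trans hsty, hyx.le⟩
            have h2 : G.Adj ⟨x, hx⟩ ⟨y, by omega⟩ := (hA ⟨x, hx⟩ ⟨y, by omega⟩).1 hxy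
            exact (hc _).2 (show (⟨x, hx⟩ : Fin n) ∈ _ from rfl) h1 h2.ne h2
          have hnot : (⟨x, hx⟩ : Fin n) ∉ S := fun h => hne _ h rfl
          refine ⟨Nat.le_succ x, insert ⟨x, hx⟩ S, ?_, ?_, ?_⟩
          · rw [Finset.card_insert_of_notMem hnot, hcard]
          · intro s hs
            rcases Finset.mem_insert.1 hs with rfl | hs
            · exact le_rfl
            · exact (hle s hs).trans hst
          · rw [Finset.coe_insert, Set.injOn_insert (by simpa using hnot)]
            refine ⟨hinj, ?_⟩
            rintro ⟨s, hs, heq⟩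
            exact hne s hs heq
        · exact ⟨by omega, S, hcard, hle, hinj⟩
    obtain ⟨-, S, hcard, -, hinj⟩ := key n le_rfl
    rw [← hcard, ← Finset.card_image_of_injOn hinj]
    exact (Finset.card_le_univ _).trans (by simp)

theorem orderedChromaticNumber_le {n : ℕ} (G : SimpleGraph (Fin n)) :
    orderedChromaticNumber G ≤ n :=
  Nat.sInf_le (intervalColorable_of_monotone id monotone_id fun _ _ hxy => hxy.ne)

end Greedy

/-! ### A program for the greedy partition. -/

namespace RAMProg
open RAMState

/-- `reg 2 :=` the number of intervals of the greedy partition of the graph. -/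
def greedy : RAMProg :=
  .seq (.const 24 0) <| .seq (.const 2 1) <| .seq (mov 10 3) <| forLoop 15 8 1 <|
    .seq (.const 7 0) <| .seq
      (forLoop 15 9 1 <| .seq (.load 17 10) <| .seq (.const 19 1) <| .seq (.add 10 10 19) <|
        .ite 17 (.seq (.sub 18 24 9) <| .ite 18 .skip <| .seq (.sub 18 8 9) <|
          .ite 18 (.const 7 1) .skip) .skip) <|
      .ite 7 (.seq (mov 24 8) <| .seq (.const 19 1) (.add 2 2 19)) .skip

theorem exec_greedy (s : RAMState) :
    Exec greedy s fun s' t => t ≤ s.reg 1 * (s.reg 1 * 13 + 13) + 7 ∧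
      s'.reg 2 = (greedyIntervals
        (fun x y => s.mem (s.reg 3 + x * s.reg 1 + y) ≠ 0) (s.reg 1)).2 := by
  set n := s.reg 1 with hn
  let A : ℕ → ℕ → Prop := fun x y => s.mem (s.reg 3 + x * n + y) ≠ 0
  simp only [greedy, exec_seq (p := .const _ _), exec_seq (p := mov _ _), exec_const,
    exec_mov (show 3 ≠ 10 by decide)]
  refine (exec_forLoop (T := n * 13 + 9) (N := n)
    (fun x s' => s'.reg 10 = s.reg 3 + x * n ∧ s'.reg 24 = (greedyIntervals A x).1 ∧
      s'.reg 2 = (greedyIntervals A x).2)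
    (by decide) (by decide) (by decide) rfl rfl (by simp [reg_setReg, hn]) ?_ ?_ ?_).imp ?_
  · intro j s' v w h
    simpa [reg_setReg] using h
  · rintro x s₁ hx hf₁ h8 ⟨h10, h24, h2⟩
    have hm₁ : s₁.mem = s.mem := (hf₁.2 rfl).trans rfl
    have h1 : s₁.reg 1 = n := (hf₁.1 1 rfl).trans rfl
    let st := (greedyIntervals A x).1
    rw [exec_seq, exec_const, exec_seq]
    refine (exec_forLoop (T := 9) (N := n)
      (fun y s' => s'.reg 10 = s.reg 3 + x * n + y ∧
        (s'.reg 7 ≠ 0 ↔ ∃ y' < y, y' < x ∧ st ≤ y' ∧ A x y'))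
      (by decide) (by decide) (by decide) rfl rfl (by simp [reg_setReg, h1]) ?_ ?_ ?_).imp ?_
    · intro j s' v w h
      simpa [reg_setReg] using h
    · rintro y s₂ hy hf₂ h9 ⟨h210, h27⟩
      have hm₂ : s₂.mem = s.mem := ((hf₂.2 rfl).trans rfl).trans hm₁
      have h28 : s₂.reg 8 = x := ((hf₂.1 8 rfl).trans rfl).trans h8
      have h224 : s₂.reg 24 = st := ((hf₂.1 24 rfl).trans rfl).trans h24
      have hsplit : (∃ y' < y + 1, y' < x ∧ st ≤ y' ∧ A x y') ↔
          (∃ y' < y, y' < x ∧ st ≤ y' ∧ A x y') ∨ (y < x ∧ st ≤ y ∧ A x y) := by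
        simp only [Nat.lt_succ_iff_lt_or_eq, or_and_right, exists_or, exists_eq_left]
      rw [hsplit]
      simp only [exec_seq, exec_load, exec_const, exec_add, exec_sub, exec_ite, exec_skip]
      simp only [reg_setReg, Nat.reduceEqDiff, if_true, if_false, h210, hm₂, h9, h28,
        h224]
      split_ifs with c1 c2 c3
      · refine ⟨by omega, by omega, ?_⟩
        have : ¬ A x y := fun h => h c1
        simp only [this, and_false, or_false]
        exact h27
      · refine ⟨by omega, by omega, ?_⟩
        have : ¬ y < x := by omega
        simp only [this, false_and, or_false]
        exact h27
      · refine ⟨by omega, by omega, ?_⟩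
        have h : y < x ∧ st ≤ y ∧ A x y := ⟨by omega, by omega, c1⟩
        simp [h]
      · refine ⟨by omega, by omega, ?_⟩
        have : ¬ st ≤ y := by omega
        simp only [this, false_and, and_false, or_false]
        exact h27
    · simp [reg_setReg, h10]
    · rintro s₂ t₂ hf₂ ⟨ht₂, h210, h27⟩
      have h28 : s₂.reg 8 = x := ((hf₂.1 8 rfl).trans rfl).trans h8
      have h224 : s₂.reg 24 = st := ((hf₂.1 24 rfl).trans rfl).trans h24
      have h22 : s₂.reg 2 = (greedyIntervals A x).2 := ((hf₂.1 2 rfl).trans rfl).trans h2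
      -- The inner loop reads the whole row to keep the pointer aligned; the test `y' < x` discards
      -- the rest.
      have hiff : (∃ y' < n, y' < x ∧ st ≤ y' ∧ A x y') ↔
          ∃ y' < x, (greedyIntervals A x).1 ≤ y' ∧ A x y' :=
        ⟨fun ⟨y, _, h⟩ => ⟨y, h⟩, fun ⟨y, h⟩ => ⟨y, by omega, h⟩⟩
      rw [hiff] at h27
      simp only [exec_seq, exec_ite, exec_const, exec_add, exec_skip,
        exec_mov (show 8 ≠ 24 by decide)]
      rw [greedyIntervals]
      by_cases h : s₂.reg 7 = 0
      · rw [if_pos h, if_neg fun h' => h27.2 h' h]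
        exact ⟨by omega, by rw [h210]; ring, h224, h22⟩
      · rw [if_neg h, if_pos (h27.1 h)]
        simp only [reg_setReg, Nat.reduceEqDiff, if_true, if_false, h210, h28,
          h22]
        exact ⟨by omega, by ring, trivial, trivial⟩
  · simp [reg_setReg, greedyIntervals]
  · rintro s₁ t₁ - ⟨ht₁, -, -, h2⟩
    refine ⟨?_, h2⟩
    rw [show n * 13 + 9 + 4 = n * 13 + 13 by ring] at ht₁
    omega

end RAMProg

/-! ## The algorithms -/

theorem OrderedGraphInst.length_encode (G : OrderedGraphInst) :
    G.encode.length = G.1 * G.1 + 1 := by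
  simp [OrderedGraphInst.encode]

theorem OrderedGraphInst.storesMatrix_encode (G : OrderedGraphInst) :
    StoresMatrix (fun i => G.encode.getD i 0) 1 G.2 := by
  classical
  intro x y
  have hlt := matrixAddr_lt 0 x.2 y.2
  rw [zero_add, zero_add] at hlt
  have hx : (⟨x * G.1 + y, hlt⟩ : Fin (G.1 * G.1)).divNat = x := by
    apply Fin.ext
    simp only [Fin.coe_divNat]
    rw [mul_comm, Nat.mul_add_div (by omega), Nat.div_eq_of_lt y.2, add_zero]
  have hy : (⟨x * G.1 + y, hlt⟩ : Fin (G.1 * G.1)).modNat = y := by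
    apply Fin.ext
    simp only [Fin.coe_modNat]
    rw [Nat.mul_add_mod', Nat.mod_eq_of_lt y.2]
  beta_reduce
  rw [show 1 + (x : ℕ) * G.1 + y = x * G.1 + y + 1 by ring, OrderedGraphInst.encode,
    List.getD_cons_succ, List.getD_eq_getElem _ _ (by simpa using hlt), List.getElem_ofFn, hx, hy]
  split_ifs with h <;> simp [h]

theorem StoresMatrix.cons {n : ℕ} {G : SimpleGraph (Fin n)} {w : List ℕ} {off : ℕ} (a : ℕ)
    (h : StoresMatrix (fun i => w.getD i 0) off G) :
    StoresMatrix (fun i => (a :: w).getD i 0) (off + 1) G := by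
  intro x y
  rw [← h x y]
  beta_reduce
  rw [show off + 1 + (x : ℕ) * n + y = off + x * n + y + 1 by ring, List.getD_cons_succ]

/-- The total time of the algorithms, apart from the time for trivial instances. -/
theorem time_le {n k t : ℕ} (hn : 1 ≤ n) (hk : 1 ≤ k) (hkn : k ≤ n)
    (ht : t ≤ n ^ (2 * k + 2) * (RAMProg.checkTime n k + (2 * k + 2) * 14 + 11) +
      n * (n * 13 + 13) + 40) :
    t ≤ max n 2 ^ (15 * max k 1) := by
  set M := max n 2 with hM
  have hnM : n ≤ M := le_max_left _ _
  have hM2 : 2 ≤ M := le_max_right _ _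
  have hkM : k ≤ M := hkn.trans hnM
  have h2 : 4 ≤ M ^ 2 := by nlinarith
  have h3 : 2 * M ^ 2 ≤ M ^ 3 := by nlinarith [sq_nonneg M]
  -- Since `M ≥ 2`, constant factors can be absorbed into powers of `M`.
  have h7 : 128 ≤ M ^ 7 := (show 128 = 2 ^ 7 by norm_num) ▸ Nat.pow_le_pow_left hM2 7
  have hc : RAMProg.checkTime n k + (2 * k + 2) * 14 + 11 ≤ M ^ 10 := by
    calc RAMProg.checkTime n k + (2 * k + 2) * 14 + 11
        ≤ M * (M * (26 * M + 5 * M + 44) + 7) + 3 + 5 * M + 15 + (2 * M + 2) * 14 + 11 := by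
          unfold RAMProg.checkTime
          gcongr
      _ ≤ 128 * M ^ 3 := by nlinarith
      _ ≤ M ^ 7 * M ^ 3 := by gcongr
      _ = M ^ 10 := by ring
  have hg : n * (n * 13 + 13) + 40 ≤ M ^ 10 := by
    calc n * (n * 13 + 13) + 40 ≤ M * (M * 13 + 13) + 40 := by gcongr
      _ ≤ 128 * M ^ 3 := by nlinarith
      _ ≤ M ^ 7 * M ^ 3 := by gcongr
      _ = M ^ 10 := by ring
  calc t ≤ M ^ (2 * k + 2) * M ^ 10 + M ^ 10 := by
        refine ht.trans ?_
        rw [add_assoc]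
        gcongr
    _ ≤ M ^ (2 * k + 2) * M ^ 10 + M ^ (2 * k + 2) * M ^ 10 := by
        gcongr
        exact Nat.le_mul_of_pos_left _ (by positivity)
    _ = 2 * M ^ (2 * k + 12) := by ring
    _ ≤ M * M ^ (2 * k + 12) := by gcongr
    _ = M ^ (2 * k + 13) := by ring
    _ ≤ M ^ (15 * max k 1) := by
        -- The constant `15` comes from `2 * k + 13 ≤ 15 * k` for `k ≥ 1`.
        refine Nat.pow_le_pow_right (by omega) ?_
        rw [max_eq_left hk]
        omega

theorem const_time_le {n k t : ℕ} (ht : t ≤ 40) : t ≤ max n 2 ^ (15 * max k 1) :=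
  calc t ≤ 2 ^ (15 * 1) := by norm_num; omega
    _ ≤ max n 2 ^ (15 * 1) := Nat.pow_le_pow_left (le_max_right _ _) _
    _ ≤ max n 2 ^ (15 * max k 1) :=
      Nat.pow_le_pow_right (by positivity) (Nat.mul_le_mul_left _ (le_max_right _ _))

namespace RAMProg
open RAMState

/-- Set the number of digits, search, and answer. -/
def searchAndAnswer : RAMProg :=
  .seq (.add 4 2 2) <| .seq (.const 14 2) <| .seq (.add 4 4 14) <| .seq search (mov 0 20)

/-- The input length, still in register `0`, is the base address of the digits: the memory behind
the input is zero, so the counter starts at `0`. -/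
theorem exec_searchAndAnswer {n k b off : ℕ} {G : SimpleGraph (Fin n)} {s : RAMState}
    (h1 : s.reg 1 = n) (h2 : s.reg 2 = k) (h3 : s.reg 3 = off) (h5 : s.reg 5 = b)
    (hn : 1 ≤ n) (hk : 1 ≤ k) (hoff : 1 ≤ off) (hM : StoresMatrix s.mem off G)
    (hB : off + n * n ≤ s.reg 0) (hzero : ∀ i, s.reg 0 ≤ i → s.mem i = 0) :
    Exec searchAndAnswer s fun s' t =>
      t ≤ n ^ (2 * k + 2) * (checkTime n k + (2 * k + 2) * 14 + 11) + 8 ∧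
      (s'.reg 0 = 0 ∨ s'.reg 0 = 1) ∧ (s'.reg 0 = 1 ↔ HasSmallEndo G k (b ≠ 0)) := by
  simp only [searchAndAnswer, exec_seq (p := .const _ _), exec_seq (p := .add _ _ _), exec_const,
    exec_add, exec_seq (p := search), exec_mov (show 20 ≠ 0 by decide)]
  have hm : k + k + 2 = 2 * k + 2 := by ring
  refine (exec_search _ ?_ ?_ ?_ ?_).imp ?_
  · simpa [reg_setReg, h1] using hn
  · simpa [reg_setReg, h2] using hk
  · simp [reg_setReg, h2, hm]
  · intro i _
    simp only [reg_setReg, mem_setReg]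
    exact hzero _ (Nat.le_add_right _ _)
  · rintro s' t - ⟨ht, h20, hiff⟩
    simp [reg_setReg, mem_setReg, h1, h2, h3, h5, hm] at ht hiff
    rw [exists_homOK_iff hn hk hoff hM hB] at hiff
    simp only [reg_setReg, if_true]
    exact ⟨by omega, h20, hiff⟩

/-- The algorithm for `coreK`. -/
def solveCoreK : RAMProg :=
  .seq (.const 14 0) <| .seq (.load 2 14) <| .seq (.const 14 1) <| .seq (.load 1 14) <|
  .seq (.const 3 2) <| .seq (.sub 14 1 2) <| .seq (.const 5 1) <| .seq (.sub 5 5 14) <|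
  .seq (.sub 14 2 1) <| .ite 14 (.const 0 0) <| .ite 2 searchAndAnswer (.const 0 0)

/-- The algorithm for `coreChi` and `coreChiTotal`. -/
def solveCoreChi : RAMProg :=
  .seq (.const 14 0) <| .seq (.load 1 14) <| .seq (.const 3 1) <| .seq (.const 5 0) <|
  .ite 1 (.seq greedy searchAndAnswer) (.const 0 1)

end RAMProg

open RAMProg RAMState

theorem coreK_solvedBy :
    coreK.SolvedBy solveCoreK fun x => max (coreK.numVerts x) 2 ^ (15 * max (coreK.param x) 1) := by
  rintro ⟨⟨n, G⟩, k⟩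
  show Exec solveCoreK (RAMState.init (k :: OrderedGraphInst.encode ⟨n, G⟩)) fun s t =>
    t ≤ max n 2 ^ (15 * max k 1) ∧ coreK.CorrectAnswer (⟨n, G⟩, k) (s.reg 0)
  set w := k :: OrderedGraphInst.encode ⟨n, G⟩ with hw
  set Y := ∃ H : G.Subgraph, H ≠ ⊤ ∧ H.verts.ncard = k ∧ HasOrderedHom G H.coe with hY
  have hans : ∀ b : ℕ, (b = 0 ∨ b = 1) → (b = 1 ↔ Y) → coreK.CorrectAnswer (⟨n, G⟩, k) b := by
    intro b hb hiff _
    rcases hb with rfl | rfl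
    · exact .inr ⟨rfl, fun h => zero_ne_one (hiff.2 h)⟩
    · exact .inl ⟨rfl, hiff.1 rfl⟩
  have hmem0 : (RAMState.init w).mem 0 = k := rfl
  have hmem1 : (RAMState.init w).mem 1 = n := rfl
  have hreg0 : (RAMState.init w).reg 0 = n * n + 2 := by
    simp [RAMState.init, hw, OrderedGraphInst.length_encode]
  simp only [solveCoreK, exec_seq, exec_const, exec_load, exec_sub, exec_ite]
  simp only [reg_setReg, mem_setReg, Nat.reduceEqDiff, OfNat.one_ne_ofNat, OfNat.ofNat_ne_one,
    if_true, if_false, hmem0, hmem1]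
  split_ifs with c1 c2
  -- Case `k = 0`: a map to a subgraph without vertices forces `G` to be empty, and then the
  -- subgraph is not proper.
  · refine ⟨const_time_le (by norm_num), hans _ (.inl rfl) ⟨fun h => absurd h zero_ne_one, ?_⟩⟩
    rintro ⟨H, hne, hcard, f, -⟩
    have hV : H.verts = ∅ := by
      rw [← Set.ncard_eq_zero (Set.toFinite _), hcard, c2]
    refine absurd (SimpleGraph.Subgraph.ext ?_ ?_) hne
    · ext v
      exact (hV ▸ (f v).2 : (f v : Fin n) ∈ (∅ : Set (Fin n))).elim
    · ext u v
      exact (hV ▸ (f u).2 : (f u : Fin n) ∈ (∅ : Set (Fin n))).elim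
  -- As `k ≤ n` here, the flag `1 - (n - k)` is nonzero exactly for `k = n`, when an edge has to be
  -- avoided.
  · refine (exec_searchAndAnswer (n := n) (k := k) (off := 2) (b := 1 - (n - k)) (G := G)
      ?_ ?_ ?_ ?_ (by omega) (by omega) (by omega) ?_ ?_ ?_).imp ?_
    · simp [reg_setReg]
    · simp [reg_setReg]
    · simp [reg_setReg]
    · simp [reg_setReg]
    · exact (OrderedGraphInst.storesMatrix_encode ⟨n, G⟩).cons k
    · simp [reg_setReg, hreg0]
      omega
    · intro i hi
      simp only [reg_setReg, mem_setReg, if_false, OfNat.zero_ne_ofNat,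
        zero_ne_one] at hi ⊢
      exact List.getD_eq_default _ _ hi
    · rintro s t - ⟨ht, h01, hiff⟩
      refine ⟨time_le (by omega) (by omega) (by omega) ?_, hans _ h01 ?_⟩
      · have := Nat.zero_le (n * (n * 13 + 13))
        omega
      · rw [hiff, hY, exists_proper_subgraph_iff G (by simp; omega)]
        have : 1 - (n - k) ≠ 0 ↔ k = Nat.card (Fin n) := by
          rw [Nat.card_eq_fintype_card, Fintype.card_fin]
          omega
        simp only [this]
  · refine ⟨const_time_le (by norm_num), hans _ (.inl rfl) ⟨fun h => absurd h zero_ne_one, ?_⟩⟩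
    rintro ⟨H, -, hcard, -⟩
    have : H.verts.ncard ≤ n := by
      simpa using Set.ncard_le_ncard (Set.subset_univ H.verts)
    omega

theorem coreChiTotal_solvedBy :
    coreChiTotal.SolvedBy solveCoreChi fun x =>
      max (coreChiTotal.numVerts x) 2 ^ (15 * max (coreChiTotal.param x) 1) := by
  rintro ⟨n, G⟩
  set k := orderedChromaticNumber G with hk
  show Exec solveCoreChi (RAMState.init (OrderedGraphInst.encode ⟨n, G⟩)) fun s t =>
    t ≤ max n 2 ^ (15 * max k 1) ∧ coreChiTotal.CorrectAnswer ⟨n, G⟩ (s.reg 0)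
  set w := OrderedGraphInst.encode ⟨n, G⟩ with hw
  have hans : ∀ b : ℕ, (b = 0 ∨ b = 1) → (b = 1 ↔ HasSmallEndo G k False) →
      coreChiTotal.CorrectAnswer ⟨n, G⟩ b := by
    intro b hb hiff _
    rw [← coreHasCard_iff] at hiff
    rcases hb with rfl | rfl
    · exact .inr ⟨rfl, fun h => zero_ne_one (hiff.2 h)⟩
    · exact .inl ⟨rfl, hiff.1 rfl⟩
  have hmem0 : (RAMState.init w).mem 0 = n := rfl
  have hreg0 : (RAMState.init w).reg 0 = n * n + 1 := by
    simp [RAMState.init, hw, OrderedGraphInst.length_encode]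
  simp only [solveCoreChi, exec_seq (p := .const _ _), exec_seq (p := .load _ _), exec_const,
    exec_load, exec_ite]
  simp only [reg_setReg, mem_setReg, Nat.reduceEqDiff, OfNat.one_ne_ofNat,
    if_true, if_false, hmem0]
  split_ifs with c1
  -- The empty graph is separate because the greedy count starts at one.
  · refine ⟨const_time_le (by norm_num), hans _ (.inr rfl) ⟨fun _ => ?_, fun _ => rfl⟩⟩
    subst c1
    exact ⟨SimpleGraph.Hom.id, monotone_id, by simp, False.elim⟩
  · have hmat := OrderedGraphInst.storesMatrix_encode ⟨n, G⟩
    rw [exec_seq]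
    refine (exec_greedy _).imp ?_
    rintro s₁ t₁ hf₁ ⟨ht₁, h2⟩
    have hm₁ : s₁.mem = fun i => w.getD i 0 := (hf₁.2 rfl).trans rfl
    have r1 : s₁.reg 1 = n := (hf₁.1 1 rfl).trans rfl
    have r3 : s₁.reg 3 = 1 := (hf₁.1 3 rfl).trans rfl
    have r5 : s₁.reg 5 = 0 := (hf₁.1 5 rfl).trans rfl
    have r0 : s₁.reg 0 = (RAMState.init w).reg 0 := (hf₁.1 0 rfl).trans rfl
    simp [reg_setReg, mem_setReg] at ht₁ h2
    have hkχ : s₁.reg 2 = k := by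
      rw [h2, hk]
      refine (orderedChromaticNumber_eq G (by omega) fun x y => ?_).symm
      exact Iff.trans (by rfl) (hmat x y)
    have hk1 : 1 ≤ k := by
      rw [← hkχ, h2]
      exact one_le_greedyIntervals _ _
    refine (exec_searchAndAnswer (G := G) r1 hkχ r3 r5 (by omega) hk1 le_rfl ?_ ?_ ?_).imp ?_
    · rw [hm₁]
      exact hmat
    · omega
    · intro i hi
      rw [hm₁]
      rw [r0] at hi
      exact List.getD_eq_default _ _ hi
    · rintro s t - ⟨ht, h01, hiff⟩
      refine ⟨time_le (by omega) hk1 (orderedChromaticNumber_le G) (by omega), hans _ h01 ?_⟩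
      simpa using hiff

/-- The same program works: a negative answer refutes `Yes`, and the promise then leaves only `No`.
-/
theorem coreChi_solvedBy :
    coreChi.SolvedBy solveCoreChi fun x =>
      max (coreChi.numVerts x) 2 ^ (15 * max (coreChi.param x) 1) := by
  intro x
  obtain ⟨s, t, hr, ht, hans⟩ := coreChiTotal_solvedBy x
  refine ⟨s, t, hr, ht, fun hprom => ?_⟩
  rcases hans (Classical.em _) with h | ⟨h0, hno⟩
  · exact .inl h
  · exact .inr ⟨h0, hprom.resolve_left hno⟩

/-! ## The class XP -/

theorem length_le_inputSize (w : List ℕ) : w.length ≤ inputSize w := by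
  induction w with
  | nil => simp [inputSize]
  | cons a w ih =>
    simp only [inputSize, List.map_cons, List.sum_cons, List.length_cons] at ih ⊢
    omega

/-- The input has more entries than the graph has vertices, so `max n 2` is at most twice the input
size; the powers of two form the factor `f`. -/
theorem ParamProblem.inXP_of_solvedBy {P : ParamProblem} {p : RAMProg} {c : ℕ}
    (h : P.SolvedBy p fun x => max (P.numVerts x) 2 ^ (c * max (P.param x) 1))
    (hsize : ∀ x, P.numVerts x + 1 ≤ (P.encode x).length) : P.InXP := by
  have hg : Primrec fun k : ℕ => c * max k 1 :=
    Primrec.nat_mul.comp (Primrec.const c) (Primrec.nat_max.comp Primrec.id (Primrec.const 1))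
  have hpow : Primrec fun k : ℕ => 2 ^ k := by
    refine (Primrec.nat_rec₁ 1 (f := fun _ b => 2 * b)
      (Primrec.nat_mul.comp (Primrec.const 2) Primrec.snd)).of_eq fun k => ?_
    induction k with
    | zero => rfl
    | succ k ih => rw [pow_succ', ← ih]
  refine ⟨p, fun k => 2 ^ (c * max k 1), fun k => c * max k 1, (hpow.comp hg).to_comp, hg.to_comp,
    fun x => ?_⟩
  obtain ⟨s, t, hr, ht, hans⟩ := h x
  refine ⟨s, t, hr, ht.trans ?_, hans⟩
  beta_reduce
  rw [← mul_pow]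
  refine Nat.pow_le_pow_left ?_ _
  have h1 := hsize x
  have h2 := length_le_inputSize (P.encode x)
  omega

theorem OrderedGraphInst.succ_le_length_encode (G : OrderedGraphInst) :
    G.1 + 1 ≤ G.encode.length := by
  rw [OrderedGraphInst.length_encode]
  have := Nat.le_mul_self G.1
  omega

theorem mainTheorem9 :
    (coreK.SolvableInTimePow ∧ coreK.InXP) ∧
    (coreChi.SolvableInTimePow ∧ coreChi.InXP) ∧
    (coreChiTotal.SolvableInTimePow ∧ coreChiTotal.InXP) := by
  refine ⟨⟨⟨_, _, coreK_solvedBy⟩, ParamProblem.inXP_of_solvedBy coreK_solvedBy fun x => ?_⟩,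
    ⟨⟨_, _, coreChi_solvedBy⟩, ParamProblem.inXP_of_solvedBy coreChi_solvedBy
      OrderedGraphInst.succ_le_length_encode⟩,
    ⟨_, _, coreChiTotal_solvedBy⟩, ParamProblem.inXP_of_solvedBy coreChiTotal_solvedBy
      OrderedGraphInst.succ_le_length_encode⟩
  exact (OrderedGraphInst.succ_le_length_encode x.1).trans (Nat.le_succ _)
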